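/- Let $L$ be a first-order language and let $M$ be a $\kappa$-saturated $L$-structure (a "monster model" of an arbitrary theory), $\kappa>\aleph_0$. Let $A\subseteq M$ with $|A|<\kappa$, let $p(y)$ be a (possibly partial) consistent type over $A$ in a finite tuple $y$ of variables, and let $k\in\mathbb N$. Formulas $\varphi(x,y)$ are $L$-formulas without parameters, where $x$ is a finite tuple of variables which may vary with the formula and $y$ is the fixed tuple of variables of $p$. Indiscernible sequences are infinite sequences of finite tuples of $M$, indexed by a linear order. Sequences $(I^j)_{j\in J}$ are *mutually indiscernible over $A$* if each $I^j$ is indiscernible over $A\cup\bigcup_{j'\neq j} I^{j'}$. *Definitions.* - **dp-rank.** For a cardinal $\mu$, $\operatorname{rk}_{dp}(p)\le\mu$ means: for every realization $c$ of $p$ and any $1+\mu$ sequences that are mutually indiscernible over $A$, at least one of them is indiscernible over $Ac$. The rank $\operatorname{rk}_{dp}(p)$ is the least $\mu$ with $\operatorname{rk}_{dp}(p)\le\mu$, and $\infty$ if there is none. - **Randomness pattern.** A randomness pattern of depth $k$ for $p$ over $A$ consists of formulas $\varphi_\alpha(x_\alpha,y)$ and sequences $(b^\alpha_i)_{i<\omega}$,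 $\alpha<k$, with $b^\alpha_i$ in the sort of $x_\alpha$, such that the sequences are mutually indiscernible over $A$ and for every $\eta:k\to\omega$ the set $\{\varphi_\alpha(b^\alpha_{\eta(\alpha)},y):\alpha<k\}\cup\{\neg\varphi_\alpha(b^\alpha_i,y):\alpha<k,\ i\ne\eta(\alpha)\}$ is consistent with $p$. - **$VC^*$-density.** For a set $X$ of tuples in the sort of $x$, the $VC^*_\varphi$-density of $p$ over $X$ is the infimum in $[0,\infty]$ of the reals $r\ge 0$ for which there is $f:\mathbb N\to\mathbb R_{\ge0}$ with $f(n)=O(n^r)$ such that for every finite $B\subseteq X$ the number of complete $\varphi$-types over $B$ consistent with $p$ is at most $f(|B|)$ (a complete $\varphi$-type over $B$ decides $\varphi(b,y)$ for each $b\in B$). The density over a sequence is the density over its set of members. - **Alternation rank.** $\operatorname{alt}^p_A(\varphi)\ge n$ means: there are an $A$-indiscernible sequence $(a_i)_{i\in I}$, a realization $c$ of $p$ and indices $i_0<\dots<i_n$ such that the truth values of $\varphi(a_{i_j},c)$ and $\varphi(a_{i_{j+1}},c)$ differ for every $j<n$. **Theorem.** The following are equivalent. 1. $\operatorname{rk}_{dp}(p)\ge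 k$. 2. There is a randomness pattern of depth $k$ for $p$ over $A$. 3. There are a formula $\varphi(x,y)$ and an $A$-indiscernible sequence $I$ in the sort of $x$ such that the $VC^*_\varphi$-density of $p$ over $I$ is at least $k$. 4. There are a formula $\varphi(x,y)$ and an $A$-indiscernible sequence $I$ in the sort of $x$ such that the $VC^*_\varphi$-density of $p$ over $I$ is greater than $k-1$. 5. There are a formula $\varphi(x,y)$ and an $A$-indiscernible sequence $(a_i)_{i\in I}$ in the sort of $x$ such that for every set $I'\subseteq I$ of exactly $k$ indices there is a realization $c$ of $p$ such that, for all $i\in I$, $M\models\varphi(a_i,c)$ if and only if $i\in I'$. 6. There is a formula $\varphi(x,y)$ with $\operatorname{alt}^p_A(\varphi)\ge 2k$. Moreover, let $\Delta$ be a non-empty set of formulas $\varphi(x,y)$ ($y$ fixed, $x$ any finite tuple of variables) that is closed under Boolean combinations, where the formulas combined may have different tuples $x$ (so $\Delta$ is closed under negation, disjunction, renaming the variables $x$ and adding dummy variables to $x$). Then the following are equivalent. 1. There is a randomness pattern of depth $k$ for $p$ over $A$ all of whose formulas are in $\Delta$ (that is, $\operatorname{rk}_{dp}(p)\ge k$ is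 witnessed by formulas in $\Delta$). 2. There are an $A$-indiscernible sequence $I$ and $\varphi(x,y)\in\Delta$ such that the $VC^*_\varphi$-density of $p$ over $I$ is at least $k$. 3. There are an $A$-indiscernible sequence $I$ and $\varphi(x,y)\in\Delta$ such that the $VC^*_\varphi$-density of $p$ over $I$ is greater than $k-1$. -/

import Mathlib

universe u v w

open FirstOrder Cardinal

namespace DpRank

section Basic

variable {L : FirstOrder.Language.{u, v}} {M : Type w} [L.Structure M]

/-- The tuple `c` realizes the set of formulas `p` over `A` (in `m` variables). -/
def Realizes {A : Set M} {m : ℕ} (p : Set (L[[A]].Formula (Fin m))) (c : Fin m → M) : Prop :=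
  ∀ ψ ∈ p, ψ.Realize c

/-- The set of formulas `p` over `A`, together with the set `Γ` of formulas with parameters in `M`
(each given by its solution set), is consistent, i.e. finitely satisfiable in `M`. -/
def ConsistentWith {A : Set M} {m : ℕ} (p : Set (L[[A]].Formula (Fin m)))
    (Γ : Set (Set (Fin m → M))) : Prop :=
  ∀ p₀ ⊆ p, p₀.Finite → ∀ Γ₀ ⊆ Γ, Γ₀.Finite → ∃ c : Fin m → M, Realizes p₀ c ∧ ∀ S ∈ Γ₀, c ∈ S

/-- `p` is a (consistent) partial type over `A`: a set of formulas with parameters in `A` that is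
finitely satisfiable in `M`. -/
def IsPartialType {A : Set M} {m : ℕ} (p : Set (L[[A]].Formula (Fin m))) : Prop :=
  ∀ p₀ ⊆ p, p₀.Finite → ∃ c : Fin m → M, Realizes p₀ c

variable (L M) in
/-- `M` is `κ`-saturated: every partial type (in finitely many variables) over a set of fewer than
`κ` parameters is realized in `M`. -/
def IsSaturated (κ : Cardinal.{w}) : Prop :=
  ∀ B : Set M, #B < κ → ∀ (n : ℕ) (q : Set (L[[B]].Formula (Fin n))),
    IsPartialType q → ∃ c : Fin n → M, Realizes q c

variable (L) in
/-- The sequence `a` of `l`-tuples, indexed by the linear order `ι`, is indiscernible over `B`. -/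
def Indiscernible (B : Set M) {ι : Type*} [LinearOrder ι] {l : ℕ} (a : ι → Fin l → M) : Prop :=
  ∀ (n : ℕ) (ψ : L[[B]].Formula (Fin n × Fin l)) (i j : Fin n → ι), StrictMono i → StrictMono j →
    (ψ.Realize (fun st => a (i st.1) st.2) ↔ ψ.Realize (fun st => a (j st.1) st.2))

/-- The set of all elements of `M` occurring in one of the sequences `a j'` with `j' ≠ j`. -/
def othersElements {J : Type*} {ι : J → Type*} {l : J → ℕ} (a : ∀ j, ι j → Fin (l j) → M)
    (j : J) : Set M :=
  {x | ∃ j', j' ≠ j ∧ ∃ (i : ι j') (t : Fin (l j')), x = a j' i t}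

variable (L) in
/-- The sequences `a j` are mutually indiscernible over `A`: each is indiscernible over `A` together
with all the other ones. -/
def MutuallyIndiscernible (A : Set M) {J : Type*} {ι : J → Type*} [∀ j, LinearOrder (ι j)]
    {l : J → ℕ} (a : ∀ j, ι j → Fin (l j) → M) : Prop :=
  ∀ j, Indiscernible L (A ∪ othersElements a j) (a j)

/-- `rk_dp(p) ≤ μ`: for every realization `c` of `p` and any `1 + μ` infinite sequences (of finite
tuples) that are mutually indiscernible over `A`, at least one is indiscernible over `Ac`. -/
def DpRankLE {A : Set M} {m : ℕ} (p : Set (L[[A]].Formula (Fin m))) (μ : Cardinal.{w}) : Prop :=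
  ∀ c : Fin m → M, Realizes p c →
    ∀ (J : Type w), #J = 1 + μ →
      ∀ (ι : J → Type w) [∀ j, LinearOrder (ι j)] [∀ j, Infinite (ι j)] (l : J → ℕ)
        (a : ∀ j, ι j → Fin (l j) → M), MutuallyIndiscernible L A a →
        ∃ j, Indiscernible L (A ∪ Set.range c) (a j)

/-- `rk_dp(p) ≥ k`. As `rk_dp(p)` is the least `μ` with `rk_dp(p) ≤ μ` (and `∞` if there is none),
this says that `k ≤ μ` whenever `rk_dp(p) ≤ μ`. -/
def DpRankGE {A : Set M} {m : ℕ} (p : Set (L[[A]].Formula (Fin m))) (k : ℕ) : Prop :=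
  ∀ μ : Cardinal.{w}, DpRankLE p μ → (k : Cardinal.{w}) ≤ μ

/-- `M ⊨ φ(b, c)`, for a formula `φ(x, y)` with `|x| = l` and `|y| = m`. -/
def Holds {l m : ℕ} (φ : L.Formula (Fin l ⊕ Fin m)) (b : Fin l → M) (c : Fin m → M) : Prop :=
  φ.Realize (Sum.elim b c)

/-- The sequences `b j` (of order type `ω`) and the formulas `φ j` form a randomness pattern for
`p` over `A`. -/
def IsRandomnessPattern {A : Set M} {m : ℕ} (p : Set (L[[A]].Formula (Fin m))) {J : Type*}
    {l : J → ℕ} (b : ∀ j, ℕ → Fin (l j) → M) (φ : ∀ j, L.Formula (Fin (l j) ⊕ Fin m)) : Prop :=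
  MutuallyIndiscernible L A b ∧
    ∀ η : J → ℕ, ConsistentWith p
      ({S | ∃ j, S = {c | Holds (φ j) (b j (η j)) c}} ∪
        {S | ∃ j i, i ≠ η j ∧ S = {c | ¬ Holds (φ j) (b j i) c}})

/-- There is a randomness pattern of depth `k` for `p` over `A`. -/
def HasRandomnessPattern {A : Set M} {m : ℕ} (p : Set (L[[A]].Formula (Fin m))) (k : ℕ) : Prop :=
  ∃ (l : Fin k → ℕ) (b : ∀ j, ℕ → Fin (l j) → M) (φ : ∀ j, L.Formula (Fin (l j) ⊕ Fin m)),
    IsRandomnessPattern p b φ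

/-- There is a randomness pattern of depth `k` for `p` over `A` all of whose formulas are in `Δ`. -/
def HasRandomnessPatternIn {A : Set M} {m : ℕ} (p : Set (L[[A]].Formula (Fin m)))
    (Δ : ∀ l : ℕ, Set (L.Formula (Fin l ⊕ Fin m))) (k : ℕ) : Prop :=
  ∃ (l : Fin k → ℕ) (b : ∀ j, ℕ → Fin (l j) → M) (φ : ∀ j, L.Formula (Fin (l j) ⊕ Fin m)),
    (∀ j, φ j ∈ Δ (l j)) ∧ IsRandomnessPattern p b φ

/-- The set of complete `φ(x, y)`-types (in the variables `y`) over the set `B` of tuples in the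
sort of `x` that are consistent with `p`. A complete `φ`-type `q` over `B` is identified with the
set `B₀` of those `b ∈ B` with `φ(b, y) ∈ q`, so that `¬ φ(b, y) ∈ q` for `b ∈ B \ B₀`. -/
def phiTypes {A : Set M} {m l : ℕ} (p : Set (L[[A]].Formula (Fin m)))
    (φ : L.Formula (Fin l ⊕ Fin m)) (B : Set (Fin l → M)) : Set (Set (Fin l → M)) :=
  {B₀ | B₀ ⊆ B ∧ ConsistentWith p
    ({S | ∃ b ∈ B₀, S = {c | Holds φ b c}} ∪ {S | ∃ b ∈ B \ B₀, S = {c | ¬ Holds φ b c}})}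

/-- The `VC*_φ`-density of `p` over a set `X` of tuples in the sort of `x`: the infimum (`∞` if there
is none) of the reals `r ≥ 0` such that the number of `φ`-types over `B` consistent with `p` is
`O(|B| ^ r)` for finite `B ⊆ X`. -/
noncomputable def vcDensity {A : Set M} {m l : ℕ} (p : Set (L[[A]].Formula (Fin m)))
    (φ : L.Formula (Fin l ⊕ Fin m)) (X : Set (Fin l → M)) : EReal :=
  sInf {e : EReal | ∃ r : ℝ, 0 ≤ r ∧ e = (r : EReal) ∧
    ∃ f : ℕ → ℝ, (∀ n, 0 ≤ f n) ∧ f =O[Filter.atTop] (fun n : ℕ => (n : ℝ) ^ r) ∧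
      ∀ B : Finset (Fin l → M), (B : Set (Fin l → M)) ⊆ X →
        ((phiTypes p φ (B : Set (Fin l → M))).ncard : ℝ) ≤ f B.card}

/-- `alt^p_A(φ) ≥ n`: for some infinite `A`-indiscernible sequence `a` and some realization `c` of
`p`, the truth value of `φ(x, c)` alternates (at least) `n` times along `a`. -/
def AltRankGE {A : Set M} {m l : ℕ} (p : Set (L[[A]].Formula (Fin m)))
    (φ : L.Formula (Fin l ⊕ Fin m)) (n : ℕ) : Prop :=
  ∃ (ι : Type w) (_ : LinearOrder ι) (_ : Infinite ι) (a : ι → Fin l → M),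
    Indiscernible L A a ∧ ∃ c : Fin m → M, Realizes p c ∧
      ∃ s : Fin (n + 1) → ι, StrictMono s ∧
        ∀ j : Fin n, ¬ (Holds φ (a (s j.castSucc)) c ↔ Holds φ (a (s j.succ)) c)

/-- A non-empty set `Δ` of formulas `φ(x, y)`, where `y` is a fixed `m`-tuple of variables and `x` is
an arbitrary finite tuple of variables (`Δ l` consists of those with `|x| = l`), is closed under
Boolean combinations. The formulas that are combined may have different tuples `x`, so this includes
closure under renaming `x` and adding dummy variables to it; thus, for instance, with `φ(x, y)` also
`φ(x₁, y) ↔ φ(x₂, y)` is in `Δ`, up to equivalence. -/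
structure BooleanClosed {m : ℕ} (Δ : ∀ l : ℕ, Set (L.Formula (Fin l ⊕ Fin m))) : Prop where
  nonempty : ∃ l, (Δ l).Nonempty
  not_mem : ∀ {l : ℕ} {φ : L.Formula (Fin l ⊕ Fin m)}, φ ∈ Δ l → φ.not ∈ Δ l
  sup_mem : ∀ {l : ℕ} {φ ψ : L.Formula (Fin l ⊕ Fin m)}, φ ∈ Δ l → ψ ∈ Δ l → φ ⊔ ψ ∈ Δ l
  rename_mem : ∀ {l l' : ℕ} (f : Fin l → Fin l'), Function.Injective f →
    ∀ {φ : L.Formula (Fin l ⊕ Fin m)}, φ ∈ Δ l → φ.relabel (Sum.map f id) ∈ Δ l'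

end Basic

end DpRank

/-! Everything passes through one configuration: `k` sequences of order type `ω` forming an
indiscernible array over `A`, such that it is consistent with `p` that for every `j` a formula `φ_j`
takes different values on the first two terms of row `j` (`ChangeConsistent`).

Such a configuration yields a randomness pattern. By indiscernibility the change can be moved to
terms `3η(j)` and `3η(j) + 1`. Among any three truth values two agree, so every other group of three
consecutive terms contains a pair without change. After thinning, the pairs `(2i, 2i + 1)` of row
`j` show a change exactly when `i = η(j)`. The formula `φ_j(x₀, y) xor φ_j(x₁, y)` on the sequence
of pairs is then the required pattern, and it stays in a Boolean closed `Δ`.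

Three sources supply changes. If `k` mutually indiscernible sequences all fail to be indiscernible
over `Ac`, each contains two tuples distinguished over `c`. If a formula alternates `2k` times along
one sequence, it changes on `k` disjoint pairs; the sequence can be stretched into `k` consecutive
mutually indiscernible segments, one around each pair. If the density exceeds `k - 1`, such pairs
exist by counting: binary words of length `n` with fewer than `k` disjoint changes number only
`O(n^(k-1))`.

Conversely, concatenating the `k` rows of a pattern into one sequence and taking the disjunction of
its formulas cuts out every `k`-element set of terms: let `η(j)` be the `j`-th element of the set.
This gives at least `n choose k` types over `n` terms, and `2k` alternations when every second of
`2k + 1` terms is cut out. Realizing a single `η` shows that the dp-rank is at least `k`. -/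

namespace DpRank

/-! ### Definable sets: substitution, parameters, finite support -/

section Definability

variable {L : FirstOrder.Language.{u, v}} {M : Type w} [L.Structure M]

theorem definable_subst {α β : Type*} {A B : Set M} (hAB : A ⊆ B) {D : Set (α → M)}
    (hD : A.Definable L D) (σ : α → B ⊕ β) :
    B.Definable L {z : β → M | (fun x => Sum.elim (fun b : B => (b : M)) z (σ x)) ∈ D} := by
  rw [Set.definable_iff_exists_formula_sum] at hD ⊢
  obtain ⟨φ, rfl⟩ := hD
  refine ⟨φ.relabel (Sum.elim (Sum.inl ∘ Set.inclusion hAB) σ), ?_⟩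
  ext z
  simp only [Set.mem_ofPred_eq, Language.Formula.realize_relabel]
  rw [iff_eq_eq]
  congr 1
  ext x
  rcases x with x | x <;> rfl

/-- Parameters from `C` are turned into variables, which leaves a relation over `A` to which
indiscernibility over `A` applies; `f` names the variable that stands for each parameter. -/
theorem exists_definable_of_parameters {α β : Type*} {A C : Set M} {D : Set (β → M)}
    (hD : (A ∪ C).Definable L D) (f : C → α) :
    ∃ E : Set ((α ⊕ β) → M), A.Definable L E ∧
      ∀ v : α → M, (∀ c : C, v (f c) = c) → ∀ z, Sum.elim v z ∈ E ↔ z ∈ D := by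
  classical
  rw [Set.definable_iff_exists_formula_sum] at hD
  obtain ⟨φ, rfl⟩ := hD
  let τ : (↥(A ∪ C)) ⊕ β → A ⊕ (α ⊕ β) := Sum.elim
    (fun x => if h : (x : M) ∈ A then Sum.inl ⟨x, h⟩
      else Sum.inr (Sum.inl (f ⟨x, x.2.resolve_left h⟩)))
    (fun y => Sum.inr (Sum.inr y))
  refine ⟨_, Set.definable_iff_exists_formula_sum.2 ⟨φ.relabel τ, rfl⟩, fun v hv z => ?_⟩
  simp only [Set.mem_ofPred_eq, Language.Formula.realize_relabel]
  rw [iff_eq_eq]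
  congr 1
  ext x
  rcases x with x | x
  · by_cases h : (x : M) ∈ A
    · simp [τ, h]
    · simp [τ, h, hv]
  · rfl

theorem exists_finset_support {α : Type*} {A : Set M} {D : Set (α → M)}
    (hD : A.Definable L D) :
    ∃ (s : Finset α) (D' : Set (s → M)), A.Definable L D' ∧
      ∀ z : α → M, z ∈ D ↔ (fun x : s => z x) ∈ D' := by
  classical
  obtain ⟨φ, rfl⟩ := hD
  refine ⟨φ.freeVarFinset, Set.ofPred (Language.Formula.Realize (φ.restrictFreeVar id)),
    ⟨_, rfl⟩, fun z => ?_⟩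
  exact (Language.BoundedFormula.realize_restrictFreeVar (f := id)
    (v := fun x : φ.freeVarFinset => z x) z (fun _ => rfl)).symm

theorem definable_realizes {A : Set M} {m : ℕ} {p : Set (L[[A]].Formula (Fin m))}
    (hp : p.Finite) : A.Definable L {c : Fin m → M | Realizes p c} := by
  have := Set.definable_biInter_finset (A := A) (L := L)
    (f := fun ψ : L[[A]].Formula (Fin m) => {c : Fin m → M | ψ.Realize c})
    (fun ψ => ⟨ψ, rfl⟩) hp.toFinset
  convert! this using 1
  ext c
  simp [Realizes]

theorem definable_holds {A : Set M} {l m : ℕ} (φ : L.Formula (Fin l ⊕ Fin m)) :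
    A.Definable L {v : Fin l ⊕ Fin m → M | φ.Realize v} :=
  (Set.empty_definable_iff.2 ⟨φ, rfl⟩ : (∅ : Set M).Definable L _).mono (Set.empty_subset A)

theorem definable_iff' {α : Type*} {A : Set M} {D E : Set (α → M)} (hD : A.Definable L D)
    (hE : A.Definable L E) : A.Definable L {v | v ∈ D ↔ v ∈ E} := by
  convert! (hD.himp hE).inter (hE.himp hD) using 1
  ext v
  simp [himp_eq]
  tauto

theorem IsSaturated.exists_mem {κ : Cardinal.{w}} (hM : IsSaturated L M κ) {B : Set M}
    (hB : #B < κ) {n : ℕ} (F : Set (Set (Fin n → M))) (hdef : ∀ S ∈ F, B.Definable L S)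
    (hfip : ∀ F₀ ⊆ F, F₀.Finite → ∃ c : Fin n → M, ∀ S ∈ F₀, c ∈ S) :
    ∃ c : Fin n → M, ∀ S ∈ F, c ∈ S := by
  obtain ⟨c, hc⟩ := hM B hB n {ψ | {c | ψ.Realize c} ∈ F} (fun p₀ hp₀ hfin => by
    obtain ⟨c, hc⟩ := hfip ((fun ψ : L[[B]].Formula (Fin n) => {c | ψ.Realize c}) '' p₀)
      (by rintro _ ⟨ψ, hψ, rfl⟩; exact hp₀ hψ) (hfin.image _)
    exact ⟨c, fun ψ hψ => hc _ ⟨ψ, hψ, rfl⟩⟩)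
  refine ⟨c, fun S hS => ?_⟩
  obtain ⟨ψ, rfl⟩ := hdef S hS
  exact hc ψ hS

end Definability

/-! ### Realizing types in countably many variables -/

section CountableSaturation

variable {L : FirstOrder.Language.{u, v}} {M : Type w} [L.Structure M]

/-- One step of realizing the limit type of `g` along `U` coordinate by coordinate: given a
realization of its restriction to the first `n` variables, only a type in one variable over fewer
than `κ` parameters remains. -/
theorem IsSaturated.exists_extend {κ : Cardinal.{w}} (hκ : ℵ₀ < κ) (hM : IsSaturated L M κ)
    {A : Set M} (hA : #A < κ) {X : Type*} (U : Ultrafilter X) (g : X → ℕ → M) (n : ℕ)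
    (h : ℕ → M)
    (hh : ∀ D : Set (Fin n → M), A.Definable L D → (∀ᶠ x in U, (fun i : Fin n => g x i) ∈ D) →
      (fun i : Fin n => h i) ∈ D) :
    ∃ y : M, ∀ D : Set (Fin (n + 1) → M), A.Definable L D →
      (∀ᶠ x in U, (fun i : Fin (n + 1) => g x i) ∈ D) →
      (fun i : Fin (n + 1) => Function.update h n y i) ∈ D := by
  let B : Set M := A ∪ Set.range (fun i : Fin n => h i)
  have hB : #B < κ := (mk_union_le _ _).trans_lt (add_lt_of_lt hκ.le hA
    ((Set.finite_range _).lt_aleph0.trans hκ))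
  let fib : Set (Fin (n + 1) → M) → Set (Fin 1 → M) := fun D =>
    {y | (fun i : Fin (n + 1) => Function.update h n (y 0) i) ∈ D}
  let F : Set (Set (Fin 1 → M)) := {S | ∃ D : Set (Fin (n + 1) → M), A.Definable L D ∧
    (∀ᶠ x in U, (fun i : Fin (n + 1) => g x i) ∈ D) ∧ S = fib D}
  suffices hF : (∀ S ∈ F, B.Definable L S) ∧
      ∀ F₀ ⊆ F, F₀.Finite → ∃ c : Fin 1 → M, ∀ S ∈ F₀, c ∈ S by
    obtain ⟨y, hy⟩ := hM.exists_mem hB F hF.1 hF.2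
    exact ⟨y 0, fun D hD hx => hy _ ⟨D, hD, hx, rfl⟩⟩
  constructor
  · rintro _ ⟨D, hD, -, rfl⟩
    convert! definable_subst (B := B) Set.subset_union_left hD
      (fun i : Fin (n + 1) => if hi : (i : ℕ) < n
        then Sum.inl ⟨h i, Or.inr ⟨⟨i, hi⟩, rfl⟩⟩ else Sum.inr (0 : Fin 1)) using 1
    ext y
    simp only [fib, Set.mem_ofPred_eq]
    rw [iff_eq_eq]
    congr 1
    ext i
    by_cases hi : (i : ℕ) < n
    · simp [hi, hi.ne]
    · have : (i : ℕ) = n := by omega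
      simp [this]
  · intro F₀ hF₀ hfin
    classical
    have hF₀' : ∀ S : Set (Fin 1 → M), S ∈ F₀ → ∃ D : Set (Fin (n + 1) → M), A.Definable L D ∧
      (∀ᶠ x in U, (fun i : Fin (n + 1) => g x i) ∈ D) ∧ S = fib D := fun S hS => hF₀ hS
    choose! D hD hU hF using hF₀'
    let D₀ : Set (Fin (n + 1) → M) := ⋂ S ∈ hfin.toFinset, (if S ∈ F₀ then D S else Set.univ)
    have hD₀ : A.Definable L D₀ := Set.definable_biInter_finset (fun S => by
      split_ifs with hS
      exacts [hD S hS, Set.definable_univ]) _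
    have hD₀U : ∀ᶠ x in U, (fun i : Fin (n + 1) => g x i) ∈ D₀ := by
      have : ∀ᶠ x in U, ∀ S ∈ F₀, (fun i : Fin (n + 1) => g x i) ∈ D S :=
        (Filter.eventually_all_finite hfin).2 hU
      filter_upwards [this] with x hx
      simp only [D₀, Set.mem_iInter]
      intro S hS
      rw [if_pos (by simpa using hS)]
      exact hx S (by simpa using hS)
    -- Finite satisfiability: the projection of `D₀` to the first `n` coordinates is definable and
    -- contains `g x` for `U`-almost all `x`, so it contains `h`.
    have hproj : A.Definable L {z : Fin n → M | ∃ y : Fin 1 → M,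
        (fun i : Fin (n + 1) => Sum.elim z y (if hi : (i : ℕ) < n then Sum.inl ⟨i, hi⟩
          else Sum.inr 0)) ∈ D₀} :=
      (hD₀.preimage_comp _).exists_of_finite
    obtain ⟨y, hy⟩ := hh _ hproj (by
      filter_upwards [hD₀U] with x hx
      refine ⟨fun _ => g x n, ?_⟩
      convert hx using 1
      ext i
      by_cases hi : (i : ℕ) < n
      · simp [hi]
      · have : (i : ℕ) = n := by omega
        simp [this])
    refine ⟨y, fun S hS => ?_⟩
    rw [hF S hS]
    simp only [D₀, Set.mem_iInter] at hy
    have := hy S (by simpa using hS)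
    rw [if_pos hS] at this
    simp only [fib, Set.mem_ofPred_eq]
    convert this using 1
    ext i
    by_cases hi : (i : ℕ) < n
    · simp [hi, hi.ne]
    · have : (i : ℕ) = n := by omega
      simp [this]

theorem IsSaturated.exists_nat {κ : Cardinal.{w}} (hκ : ℵ₀ < κ) (hM : IsSaturated L M κ)
    {A : Set M} (hA : #A < κ) [Nonempty M] {X : Type*} (U : Ultrafilter X) (g : X → ℕ → M) :
    ∃ h : ℕ → M, ∀ D : Set (ℕ → M), A.Definable L D → (∀ᶠ x in U, g x ∈ D) → h ∈ D := by
  classical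
  let P : ℕ → (ℕ → M) → Prop := fun n h => ∀ D : Set (Fin n → M), A.Definable L D →
    (∀ᶠ x in U, (fun i : Fin n => g x i) ∈ D) → (fun i : Fin n => h i) ∈ D
  have step : ∀ n h, ∃ y, P n h → P (n + 1) (Function.update h n y) := fun n h => by
    by_cases hP : P n h
    · obtain ⟨y, hy⟩ := hM.exists_extend hκ hA U g n h hP
      exact ⟨y, fun _ => hy⟩
    · exact ⟨Classical.arbitrary M, fun h' => absurd h' hP⟩
  choose y hy using step
  let s : ℕ → ℕ → M := fun n => Nat.rec (fun _ => Classical.arbitrary M)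
    (fun n h => Function.update h n (y n h)) n
  have hs : ∀ n, s (n + 1) = Function.update (s n) n (y n (s n)) := fun n => rfl
  have hP : ∀ n, P n (s n) := by
    intro n
    induction n with
    | zero =>
      intro D _ hU
      obtain ⟨x, hx⟩ := hU.exists
      convert hx
    | succ n ih => rw [hs]; exact hy n _ ih
  have hst : ∀ n i, i < n → s n i = s (i + 1) i := by
    intro n
    induction n with
    | zero => intro i hi; omega
    | succ n ih =>
      intro i hi
      rcases Nat.lt_succ_iff_lt_or_eq.1 hi with h | rfl
      · rw [hs, Function.update_of_ne h.ne, ih i h]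
      · rfl
  refine ⟨fun i => s (i + 1) i, fun D hD hU => ?_⟩
  -- A definable condition mentions finitely many coordinates, and these are final from some stage
  -- `n` on.
  obtain ⟨t, D', hD', hDD'⟩ := exists_finset_support hD
  obtain ⟨n, hn⟩ : ∃ n, ∀ i ∈ t, i < n := ⟨t.sup id + 1, fun i hi =>
    Nat.lt_succ_of_le (Finset.le_sup (f := id) hi)⟩
  have := hP n _ (hD'.preimage_comp (fun i : t => (⟨i, hn i i.2⟩ : Fin n))) (by
    filter_upwards [hU] with x hx
    exact (hDD' _).1 hx)
  rw [hDD']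
  have heq : (fun i : t => s (i + 1) i) = fun i : t => s n i :=
    funext fun i => (hst n i (hn i i.2)).symm
  rw [heq]
  exact this

theorem IsSaturated.exists_countable {κ : Cardinal.{w}} (hκ : ℵ₀ < κ) (hM : IsSaturated L M κ)
    {A : Set M} (hA : #A < κ) [Nonempty M] {V : Type*} [Countable V] {X : Type*}
    (U : Ultrafilter X) (g : X → V → M) :
    ∃ h : V → M, ∀ D : Set (V → M), A.Definable L D → (∀ᶠ x in U, g x ∈ D) → h ∈ D := by
  obtain ⟨f, hf⟩ := exists_injective_nat V
  obtain ⟨h, hh⟩ := hM.exists_nat hκ hA U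
    (fun x => Function.extend f (g x) (fun _ => Classical.arbitrary M))
  refine ⟨h ∘ f, fun D hD hU => hh _ (hD.preimage_comp f) ?_⟩
  filter_upwards [hU] with x hx
  rw [Set.mem_preimage, Function.extend_comp hf]
  exact hx

end CountableSaturation

/-! ### Indiscernible arrays and mutual indiscernibility -/

section Arrays

variable {L : FirstOrder.Language.{u, v}} {M : Type w} [L.Structure M]

variable (L) in
/-- The family of `ω`-sequences `d j` is an indiscernible array over `A`: the type of the whole
array does not change when each of the sequences is replaced by a subsequence. -/
def ArrayIndiscernible (A : Set M) {J : Type*} {T : J → Type*} (d : ∀ j, ℕ → T j → M) : Prop :=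
  ∀ D : Set ((Σ j, ℕ × T j) → M), A.Definable L D → ∀ e e' : J → ℕ → ℕ,
    (∀ j, StrictMono (e j)) → (∀ j, StrictMono (e' j)) →
    ((fun v : Σ j, ℕ × T j => d v.1 (e v.1 v.2.1) v.2.2) ∈ D ↔
      (fun v : Σ j, ℕ × T j => d v.1 (e' v.1 v.2.1) v.2.2) ∈ D)

/-- A strictly monotone finite sequence of natural numbers extends to an infinite one. -/
theorem exists_strictMono_extend {n : ℕ} (i : Fin n → ℕ) (hi : StrictMono i) :
    ∃ f : ℕ → ℕ, StrictMono f ∧ ∀ x : Fin n, f x = i x := by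
  refine ⟨fun x => if h : x < n then i ⟨x, h⟩ else x + (∑ y, i y), ?_, fun x => by simp⟩
  refine strictMono_nat_of_lt_succ fun x => ?_
  by_cases h : x + 1 < n
  · have h' : x < n := by omega
    simp only [h, h', dif_pos]
    exact hi (by simp [Fin.lt_def])
  · by_cases h' : x < n
    · simp only [h, h', dif_pos, dif_neg, not_false_iff]
      have := Finset.single_le_sum (f := i) (fun _ _ => Nat.zero_le _)
        (Finset.mem_univ (⟨x, h'⟩ : Fin n))
      omega
    · simp only [h, h', dif_neg, not_false_iff]
      omega

theorem exists_bounded_support {J : Type*} {T : J → Type*} {A : Set M}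
    {D : Set ((Σ j, ℕ × T j) → M)} (hD : A.Definable L D) :
    ∃ (n : ℕ) (D' : Set ((Σ j, Fin n × T j) → M)), A.Definable L D' ∧
      ∀ z : (Σ j, ℕ × T j) → M,
        z ∈ D ↔ (fun v : Σ j, Fin n × T j => z ⟨v.1, v.2.1, v.2.2⟩) ∈ D' := by
  obtain ⟨t, D', hD', hDD'⟩ := exists_finset_support hD
  obtain ⟨n, hn⟩ : ∃ n, ∀ v ∈ t, v.2.1 < n := ⟨t.sup (fun v => v.2.1) + 1, fun v hv =>
    Nat.lt_succ_of_le (Finset.le_sup (f := fun v : Σ j, ℕ × T j => v.2.1) hv)⟩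
  exact ⟨n, _, hD'.preimage_comp
    (fun v : t => (⟨v.1.1, ⟨v.1.2.1, hn _ v.2⟩, v.1.2.2⟩ : Σ j, Fin n × T j)),
    fun z => hDD' z⟩

/-- The entries of the other rows become variables again, and array indiscernibility is applied to
subsequences that are the identity on every row except `j`. -/
theorem ArrayIndiscernible.mutuallyIndiscernible {A : Set M} {J : Type*} {l : J → ℕ}
    {d : ∀ j, ℕ → Fin (l j) → M} (h : ArrayIndiscernible L A d) :
    MutuallyIndiscernible L A d := by
  classical
  intro j n ψ i i' hi hi'
  have hex : ∀ c : othersElements d j, ∃ v : Σ j, ℕ × Fin (l j), v.1 ≠ j ∧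
      (c : M) = d v.1 v.2.1 v.2.2 := by
    rintro ⟨c, j', hj, s, t, rfl⟩
    exact ⟨⟨j', s, t⟩, hj, rfl⟩
  choose f hfj hf using hex
  obtain ⟨E, hE, hEψ⟩ := exists_definable_of_parameters (A := A) (C := othersElements d j)
    (D := {z | ψ.Realize z}) ⟨ψ, rfl⟩ f
  obtain ⟨g, hg, hgi⟩ := exists_strictMono_extend i hi
  obtain ⟨g', hg', hgi'⟩ := exists_strictMono_extend i' hi'
  have hupd : ∀ g : ℕ → ℕ, StrictMono g → ∀ j', StrictMono (Function.update (fun _ => id) j g j')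
      := by
    intro g hg j'
    by_cases hj : j' = j
    · subst hj; simpa using hg
    · simpa [hj] using strictMono_id
  have key := h _ (hE.preimage_comp (Sum.elim (fun v : Σ j, ℕ × Fin (l j) => v)
    (fun st : Fin n × Fin (l j) => (⟨j, st.1, st.2⟩ : Σ j, ℕ × Fin (l j)))))
    (Function.update (fun _ => id) j g) (Function.update (fun _ => id) j g')
    (hupd g hg) (hupd g' hg')
  have main : ∀ (g : ℕ → ℕ) (i : Fin n → ℕ), (∀ x : Fin n, g x = i x) →
      ((fun v : Σ j, ℕ × Fin (l j) => d v.1 (Function.update (fun _ => id) j g v.1 v.2.1) v.2.2) ∈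
        (fun z => z ∘ (Sum.elim (fun v : Σ j, ℕ × Fin (l j) => v)
          (fun st : Fin n × Fin (l j) => (⟨j, st.1, st.2⟩ : Σ j, ℕ × Fin (l j))))) ⁻¹' E ↔
      ψ.Realize (fun st => d j (i st.1) st.2)) := by
    intro g i hgi
    have := hEψ (fun v => d v.1 (Function.update (fun _ => id) j g v.1 v.2.1) v.2.2)
      (fun c => by rw [hf c]; simp [hfj c]) (fun st => d j (i st.1) st.2)
    rw [Set.mem_ofPred_eq] at this
    rw [← this, Set.mem_preimage, iff_eq_eq]
    congr 1
    ext x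
    rcases x with x | x
    · rfl
    · simp [hgi]
  rw [main g i hgi, main g' i' hgi'] at key
  exact key

theorem Indiscernible.mem_iff {B : Set M} {ι : Type*} [LinearOrder ι] {l : ℕ} {a : ι → Fin l → M}
    (h : Indiscernible L B a) {n : ℕ} {D : Set (Fin n × Fin l → M)} (hD : B.Definable L D)
    {i j : Fin n → ι} (hi : StrictMono i) (hj : StrictMono j) :
    (fun st : Fin n × Fin l => a (i st.1) st.2) ∈ D ↔
      (fun st : Fin n × Fin l => a (j st.1) st.2) ∈ D := by
  obtain ⟨ψ, rfl⟩ := hD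
  exact h n ψ i j hi hj

/-- The index tuples are exchanged one row at a time, treating the entries of the remaining rows as
parameters; finiteness of `J` makes this process end. -/
theorem MutuallyIndiscernible.mem_iff {A : Set M} {J : Type*} [Finite J] {ι : J → Type*}
    [∀ j, LinearOrder (ι j)] {l : J → ℕ} {a : ∀ j, ι j → Fin (l j) → M}
    (h : MutuallyIndiscernible L A a) {n : ℕ} {D : Set ((Σ j, Fin n × Fin (l j)) → M)}
    (hD : A.Definable L D) {e e' : ∀ j, Fin n → ι j} (he : ∀ j, StrictMono (e j))
    (he' : ∀ j, StrictMono (e' j)) :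
    (fun v : Σ j, Fin n × Fin (l j) => a v.1 (e v.1 v.2.1) v.2.2) ∈ D ↔
      (fun v : Σ j, Fin n × Fin (l j) => a v.1 (e' v.1 v.2.1) v.2.2) ∈ D := by
  classical
  have single : ∀ (j : J) (e : ∀ j, Fin n → ι j) (f : Fin n → ι j), (∀ j, StrictMono (e j)) →
      StrictMono f → ((fun v : Σ j, Fin n × Fin (l j) => a v.1 (e v.1 v.2.1) v.2.2) ∈ D ↔
        (fun v : Σ j, Fin n × Fin (l j) => a v.1 (Function.update e j f v.1 v.2.1) v.2.2) ∈ D) := by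
    intro j e f he hf
    have hdef := definable_subst (B := A ∪ othersElements a j) Set.subset_union_left hD
      (fun v => if hv : v.1 = j then Sum.inr (v.2.1, Fin.cast (congrArg l hv) v.2.2)
        else Sum.inl ⟨a v.1 (e v.1 v.2.1) v.2.2, Or.inr ⟨v.1, hv, _, _, rfl⟩⟩)
    have := (h j).mem_iff hdef (he j) hf
    simp only [Set.mem_ofPred_eq] at this
    convert! this using 2
    · ext ⟨j', r, t⟩
      by_cases hj : j' = j
      · subst hj; simp
      · simp [hj]
    · ext ⟨j', r, t⟩
      by_cases hj : j' = j
      · subst hj; simp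
      · simp [hj]
  cases nonempty_fintype J
  suffices H : ∀ (s : Finset J) (e e' : ∀ j, Fin n → ι j), (∀ j, StrictMono (e j)) →
      (∀ j, StrictMono (e' j)) → (∀ j, j ∉ s → e j = e' j) →
      ((fun v : Σ j, Fin n × Fin (l j) => a v.1 (e v.1 v.2.1) v.2.2) ∈ D ↔
        (fun v : Σ j, Fin n × Fin (l j) => a v.1 (e' v.1 v.2.1) v.2.2) ∈ D) from
    H Finset.univ e e' he he' (by simp)
  intro s
  induction s using Finset.induction_on with
  | empty =>
    intro e e' _ _ hee
    have : e = e' := funext fun j => hee j (by simp)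
    rw [this]
  | insert j s _ ih =>
    intro e e' he he' hee
    rw [single j e (e' j) he (he' j)]
    refine ih _ _ (fun j' => ?_) he' (fun j' hj' => ?_)
    · by_cases hj : j' = j
      · subst hj; simpa using he' j'
      · simpa [hj] using he j'
    · by_cases hj : j' = j
      · subst hj; simp
      · simp only [ne_eq, hj, not_false_eq_true, Function.update_of_ne]
        exact hee j' (by simp [hj, hj'])

theorem MutuallyIndiscernible.arrayIndiscernible {A : Set M} {J : Type*} [Finite J] {l : J → ℕ}
    {d : ∀ j, ℕ → Fin (l j) → M} (h : MutuallyIndiscernible L A d) :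
    ArrayIndiscernible L A d := by
  intro D hD e e' he he'
  obtain ⟨n, D', hD', hDD'⟩ := exists_bounded_support hD
  rw [hDD', hDD']
  exact h.mem_iff hD' (e := fun j x => e j x) (e' := fun j x => e' j x)
    (fun j => (he j).comp Fin.val_strictMono) (fun j => (he' j).comp Fin.val_strictMono)

theorem MutuallyIndiscernible.comp {A : Set M} {J K : Type*} {ι : J → Type*}
    [∀ j, LinearOrder (ι j)] {l : J → ℕ} {a : ∀ j, ι j → Fin (l j) → M}
    (h : MutuallyIndiscernible L A a) {f : K → J} (hf : Function.Injective f) :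
    MutuallyIndiscernible L A (fun k => a (f k)) := by
  intro k n ψ i j hi hj
  have hsub : A ∪ othersElements (fun k => a (f k)) k ⊆ A ∪ othersElements a (f k) := by
    refine Set.union_subset_union_right _ ?_
    rintro x ⟨k', hk, i, t, rfl⟩
    exact ⟨f k', fun h => hk (hf h), i, t, rfl⟩
  exact (h (f k)).mem_iff (Set.Definable.mono ⟨ψ, rfl⟩ hsub :
    Set.Definable _ L {z | ψ.Realize z}) hi hj

theorem MutuallyIndiscernible.comp_strictMono {A : Set M} {J : Type*} {ι ι' : J → Type*}
    [∀ j, LinearOrder (ι j)] [∀ j, LinearOrder (ι' j)] {l : J → ℕ} {a : ∀ j, ι j → Fin (l j) → M}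
    (h : MutuallyIndiscernible L A a) {f : ∀ j, ι' j → ι j} (hf : ∀ j, StrictMono (f j)) :
    MutuallyIndiscernible L A (fun j i => a j (f j i)) := by
  intro k n ψ i j hi hj
  have hsub : A ∪ othersElements (fun j i => a j (f j i)) k ⊆ A ∪ othersElements a k := by
    refine Set.union_subset_union_right _ ?_
    rintro x ⟨k', hk, i, t, rfl⟩
    exact ⟨k', hk, f k' i, t, rfl⟩
  exact (h k).mem_iff (Set.Definable.mono ⟨ψ, rfl⟩ hsub :
    Set.Definable _ L {z | ψ.Realize z}) ((hf k).comp hi) ((hf k).comp hj)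

/-- The array `d` realizes the limit type of the approximations `g N` along a nonprincipal
ultrafilter. Indiscernibility is asked only eventually for each formula, so the late terms of each
`g N` may be arbitrary. -/
theorem exists_arrayIndiscernible {κ : Cardinal.{w}} (hκ : ℵ₀ < κ) (hM : IsSaturated L M κ)
    {A : Set M} (hA : #A < κ) [Nonempty M] {J : Type*} [Countable J] {T : J → Type*}
    [∀ j, Countable (T j)] (g : ℕ → ∀ j, ℕ → T j → M)
    (hg : ∀ (n : ℕ) (D : Set ((Σ j, Fin n × T j) → M)), A.Definable L D →
      ∀ e e' : J → Fin n → ℕ, (∀ j, StrictMono (e j)) → (∀ j, StrictMono (e' j)) →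
      ∀ᶠ N in Filter.atTop, ((fun v : Σ j, Fin n × T j => g N v.1 (e v.1 v.2.1) v.2.2) ∈ D ↔
        (fun v : Σ j, Fin n × T j => g N v.1 (e' v.1 v.2.1) v.2.2) ∈ D)) :
    ∃ d : ∀ j, ℕ → T j → M, ArrayIndiscernible L A d ∧
      ∀ D : Set ((Σ j, ℕ × T j) → M), A.Definable L D →
        (∀ᶠ N in Filter.atTop, (fun v : Σ j, ℕ × T j => g N v.1 v.2.1 v.2.2) ∈ D) →
        (fun v : Σ j, ℕ × T j => d v.1 v.2.1 v.2.2) ∈ D := by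
  have hU : ((Filter.hyperfilter ℕ : Ultrafilter ℕ) : Filter ℕ) ≤ Filter.atTop :=
    Nat.hyperfilter_le_atTop
  obtain ⟨h, hh⟩ := hM.exists_countable hκ hA (Filter.hyperfilter ℕ)
    (fun N (v : Σ j, ℕ × T j) => g N v.1 v.2.1 v.2.2)
  refine ⟨fun j i t => h ⟨j, i, t⟩, fun D hD e e' he he' => ?_,
    fun D hD hN => hh D hD (hN.filter_mono hU)⟩
  let F : (J → ℕ → ℕ) → (Σ j, ℕ × T j) → (Σ j, ℕ × T j) :=
    fun e v => ⟨v.1, e v.1 v.2.1, v.2.2⟩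
  refine hh {z | z ∘ F e ∈ D ↔ z ∘ F e' ∈ D}
    (definable_iff' (hD.preimage_comp (F e)) (hD.preimage_comp (F e'))) ?_
  obtain ⟨n, D', hD', hDD'⟩ := exists_bounded_support hD
  filter_upwards [(hg n D' hD' (fun j x => e j x) (fun j x => e' j x)
    (fun j => (he j).comp Fin.val_strictMono)
    (fun j => (he' j).comp Fin.val_strictMono)).filter_mono hU] with N hN
  rw [hDD', hDD']
  exact hN

/-- Grouping row `j` into consecutive blocks of length `n j`, possibly together with fixed
parameters from `A`, preserves indiscernibility because a subsequence of blocks comes from a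
subsequence of terms. -/
theorem ArrayIndiscernible.blocks {A : Set M} {J : Type*} {T T' : J → Type*}
    {d : ∀ j, ℕ → T j → M} (h : ArrayIndiscernible L A d) (n : J → ℕ) (hn : ∀ j, 0 < n j)
    (τ : ∀ j, T' j → A ⊕ (Fin (n j) × T j)) :
    ArrayIndiscernible L A (fun j s t' => Sum.elim (fun q : A => (q : M))
      (fun rt : Fin (n j) × T j => d j (n j * s + rt.1) rt.2) (τ j t')) := by
  intro D hD e e' he he'
  have hdef := definable_subst (B := A) subset_rfl hD (fun v : Σ j, ℕ × T' j =>
    Sum.map id (fun rt : Fin (n v.1) × T v.1 =>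
      (⟨v.1, n v.1 * v.2.1 + rt.1, rt.2⟩ : Σ j, ℕ × T j)) (τ v.1 v.2.2))
  -- The term at position `x % n j` of block `x / n j` goes to the same position of block `e j (x /
  -- n j)`.
  let F : (J → ℕ → ℕ) → J → ℕ → ℕ := fun e j x => n j * e j (x / n j) + x % n j
  have hF : ∀ e : J → ℕ → ℕ, (∀ j, StrictMono (e j)) → ∀ j, StrictMono (F e j) := by
    intro e he j
    refine strictMono_nat_of_lt_succ fun x => ?_
    have h0 := hn j
    rcases lt_or_eq_of_le (Nat.div_le_div_right (c := n j) (Nat.le_succ x)) with hlt | heq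
    · have h1 := he j hlt
      have h2 := Nat.mod_lt x h0
      have h3 : n j * (e j (x / n j) + 1) ≤ n j * e j ((x + 1) / n j) :=
        Nat.mul_le_mul_left _ h1
      rw [mul_add, mul_one] at h3
      simp only [F]
      omega
    · have h1 := Nat.div_add_mod x (n j)
      have h2 := Nat.div_add_mod (x + 1) (n j)
      simp only [F, Nat.succ_eq_add_one] at heq ⊢
      rw [← heq] at h2 ⊢
      omega
  have main : ∀ e : J → ℕ → ℕ,
      ((fun v : Σ j, ℕ × T j => d v.1 (F e v.1 v.2.1) v.2.2) ∈
        {z : (Σ j, ℕ × T j) → M | (fun v : Σ j, ℕ × T' j =>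
          Sum.elim (fun q : A => (q : M)) z (Sum.map id (fun rt : Fin (n v.1) × T v.1 =>
          (⟨v.1, n v.1 * v.2.1 + rt.1, rt.2⟩ : Σ j, ℕ × T j)) (τ v.1 v.2.2))) ∈ D} ↔
      (fun v : Σ j, ℕ × T' j => Sum.elim (fun q : A => (q : M))
        (fun rt : Fin (n v.1) × T v.1 => d v.1 (n v.1 * e v.1 v.2.1 + rt.1) rt.2)
          (τ v.1 v.2.2)) ∈ D) := by
    intro e
    rw [Set.mem_ofPred_eq, iff_eq_eq]
    congr 1
    ext ⟨j, s, t⟩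
    simp only
    rcases τ j t with q | ⟨r, t⟩
    · rfl
    · simp [F, Nat.mul_add_div (hn j), Nat.div_eq_of_lt r.2, Nat.mod_eq_of_lt r.2]
  have := h _ hdef (F e) (F e') (hF e he) (hF e' he')
  rw [main, main] at this
  exact this

end Arrays

/-! ### From a consistent change to a randomness pattern -/

section Patterns

variable {L : FirstOrder.Language.{u, v}} {M : Type w} [L.Structure M]

/-- It is consistent with `p` that each `E j` distinguishes the first two terms of the sequence
`d j`. -/
def ChangeConsistent {A : Set M} {m : ℕ} (p : Set (L[[A]].Formula (Fin m))) {J : Type*}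
    {T : J → Type*} (d : ∀ j, ℕ → T j → M) (E : ∀ j, Set (T j ⊕ Fin m → M)) : Prop :=
  ∀ p₀ ⊆ p, p₀.Finite → ∃ c : Fin m → M, Realizes p₀ c ∧
    ∀ j, ¬ (Sum.elim (d j 0) c ∈ E j ↔ Sum.elim (d j 1) c ∈ E j)

/-- Quantifying `c` existentially leaves a definable condition on the array alone. The witness may
change when the subsequence does. -/
theorem ArrayIndiscernible.exists_mem {A : Set M} {J : Type*} {T : J → Type*} {m : ℕ}
    {d : ∀ j, ℕ → T j → M} (h : ArrayIndiscernible L A d)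
    {G : Set ((Σ j, ℕ × T j) ⊕ Fin m → M)} (hG : A.Definable L G) {e e' : J → ℕ → ℕ}
    (he : ∀ j, StrictMono (e j)) (he' : ∀ j, StrictMono (e' j))
    (hc : ∃ c : Fin m → M,
      Sum.elim (fun v : Σ j, ℕ × T j => d v.1 (e v.1 v.2.1) v.2.2) c ∈ G) :
    ∃ c : Fin m → M, Sum.elim (fun v : Σ j, ℕ × T j => d v.1 (e' v.1 v.2.1) v.2.2) c ∈ G :=
  (h _ hG.exists_of_finite e e' he he').1 hc

/-- The condition that `y` realizes `p₀` and that, for all `j` and `i`, the tuples of variables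
`f j i` and `g j i` are distinguished by `E j` if and only if `R j i`. -/
theorem definable_realizes_inter_changes {A : Set M} {m : ℕ} {p₀ : Set (L[[A]].Formula (Fin m))}
    (hp₀ : p₀.Finite) {J : Type*} [Finite J] {T : J → Type*} {V I : Type*} [Finite I]
    {E : ∀ j, Set (T j ⊕ Fin m → M)} (hE : ∀ j, A.Definable L (E j)) (f g : ∀ j, I → T j → V)
    (R : J → I → Prop) :
    A.Definable L {v : V ⊕ Fin m → M | Realizes p₀ (fun y => v (Sum.inr y)) ∧
      ∀ j i, ¬ (Sum.elim (fun t => v (Sum.inl (f j i t))) (fun y => v (Sum.inr y)) ∈ E j ↔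
        Sum.elim (fun t => v (Sum.inl (g j i t))) (fun y => v (Sum.inr y)) ∈ E j) ↔ R j i} := by
  classical
  have h1 : A.Definable L {v : V ⊕ Fin m → M | Realizes p₀ (fun y => v (Sum.inr y))} :=
    (definable_realizes hp₀).preimage_comp Sum.inr
  have h2 : ∀ (j : J) (s : T j → V), A.Definable L {v : V ⊕ Fin m → M |
      Sum.elim (fun t => v (Sum.inl (s t))) (fun y => v (Sum.inr y)) ∈ E j} := by
    intro j s
    convert! (hE j).preimage_comp (Sum.map s id) using 1
    ext v
    rw [Set.mem_preimage, Set.mem_ofPred_eq, iff_eq_eq]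
    congr 1
    ext x
    rcases x with x | x <;> rfl
  have h3 : ∀ j i, A.Definable L {v : V ⊕ Fin m → M |
      ¬ (Sum.elim (fun t => v (Sum.inl (f j i t))) (fun y => v (Sum.inr y)) ∈ E j ↔
        Sum.elim (fun t => v (Sum.inl (g j i t))) (fun y => v (Sum.inr y)) ∈ E j) ↔ R j i} := by
    intro j i
    have := definable_iff' (h2 j (f j i)) (h2 j (g j i))
    by_cases hR : R j i
    · simpa [hR] using! this.compl
    · simpa [hR] using! this
  convert! h1.inter (Set.definable_iInter_of_finite fun j =>
    Set.definable_iInter_of_finite fun i => h3 j i) using 1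
  ext v
  simp

/-- From each triple `3i, 3i + 1, 3i + 2` two terms are kept: the changing pair if `i = s`,
otherwise two terms with equal truth values, which exist by pigeonhole. -/
theorem exists_strictMono_change {P : ℕ → Prop} {s : ℕ} (hs : ¬ (P (3 * s) ↔ P (3 * s + 1))) :
    ∃ e : ℕ → ℕ, StrictMono e ∧ ∀ i, ¬ (P (e (2 * i)) ↔ P (e (2 * i + 1))) ↔ i = s := by
  have : ∀ i, ∃ a b : ℕ, a < b ∧ b < 3 ∧ (¬ (P (3 * i + a) ↔ P (3 * i + b)) ↔ i = s) := by
    intro i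
    by_cases hi : i = s
    · subst hi
      exact ⟨0, 1, by simp, by simp, by simpa using hs⟩
    · simp only [hi, iff_false, not_not]
      by_cases h01 : P (3 * i + 0) ↔ P (3 * i + 1)
      · exact ⟨0, 1, by simp, by simp, h01⟩
      · by_cases h02 : P (3 * i + 0) ↔ P (3 * i + 2)
        · exact ⟨0, 2, by simp, by simp, h02⟩
        · exact ⟨1, 2, by simp, by simp, by tauto⟩
  choose a b hab hb h using this
  refine ⟨fun x => 3 * (x / 2) + if x % 2 = 0 then a (x / 2) else b (x / 2), ?_, fun i => ?_⟩
  · refine strictMono_nat_of_lt_succ fun x => ?_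
    rcases Nat.even_or_odd' x with ⟨i, rfl | rfl⟩
    · have h1 : (2 * i) / 2 = i := by omega
      have h2 : (2 * i + 1) / 2 = i := by omega
      have h3 : (2 * i + 1) % 2 = 1 := by omega
      simp only [h1, h2, h3]
      simpa using hab i
    · have h1 : (2 * i + 1) / 2 = i := by omega
      have h2 : (2 * i + 1 + 1) / 2 = i + 1 := by omega
      have h3 : (2 * i + 1) % 2 = 1 := by omega
      have h4 : (2 * i + 1 + 1) % 2 = 0 := by omega
      simp only [h1, h2, h3, h4]
      have := hb i
      simp
      omega
  · have h1 : (2 * i) / 2 = i := by omega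
    have h2 : (2 * i + 1) / 2 = i := by omega
    have h3 : (2 * i + 1) % 2 = 1 := by omega
    simp only [h1, h2, h3]
    simpa using h i

theorem ArrayIndiscernible.exists_change_iff {A : Set M} {m : ℕ}
    {p : Set (L[[A]].Formula (Fin m))} {J : Type*} [Finite J] {T : J → Type*}
    {d : ∀ j, ℕ → T j → M} (h : ArrayIndiscernible L A d)
    {E : ∀ j, Set (T j ⊕ Fin m → M)} (hE : ∀ j, A.Definable L (E j))
    (hd : ChangeConsistent p d E) (η : J → ℕ) (N : ℕ) {p₀ : Set (L[[A]].Formula (Fin m))}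
    (hp₀ : p₀ ⊆ p) (hfin : p₀.Finite) :
    ∃ c : Fin m → M, Realizes p₀ c ∧ ∀ j, ∀ i < N,
      (¬ (Sum.elim (d j (2 * i)) c ∈ E j ↔ Sum.elim (d j (2 * i + 1)) c ∈ E j) ↔ i = η j) := by
  obtain ⟨c₀, hc₀p, hc₀⟩ := hd p₀ hp₀ hfin
  -- Shift row `j` by `3 * η j`, so that the change occurs at the start of the triple with index `η
  -- j`.
  obtain ⟨c₁, hc₁p, hc₁⟩ := h.exists_mem (definable_realizes_inter_changes hfin hE
      (I := Unit) (fun j _ t => ⟨j, 0, t⟩) (fun j _ t => ⟨j, 1, t⟩) (fun _ _ => True))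
      (e := fun _ x => x) (e' := fun j x => 3 * η j + x) (fun _ => strictMono_id)
      (fun j => strictMono_nat_of_lt_succ fun x => by omega)
      ⟨c₀, hc₀p, fun j _ => by simpa using! hc₀ j⟩
  have hex : ∀ j, ∃ e : ℕ → ℕ, StrictMono e ∧ ∀ i,
      ¬ (Sum.elim (d j (e (2 * i))) c₁ ∈ E j ↔ Sum.elim (d j (e (2 * i + 1))) c₁ ∈ E j) ↔
        i = η j := fun j =>
    exists_strictMono_change (P := fun i => Sum.elim (d j i) c₁ ∈ E j)
      (by simpa using! hc₁ j ())
  choose e he hee using hex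
  -- Transfer from the thinned rows back to the whole rows. The bound `N` keeps the condition a
  -- single definable set.
  obtain ⟨c₂, hc₂p, hc₂⟩ := h.exists_mem (definable_realizes_inter_changes hfin hE
      (I := Fin N) (fun j i t => ⟨j, 2 * i, t⟩) (fun j i t => ⟨j, 2 * i + 1, t⟩) (fun j i => (i : ℕ) = η j))
      (e := e) (e' := fun _ x => x) he (fun _ => strictMono_id)
      ⟨c₁, hc₁p, fun j i => by simpa using! hee j i⟩
  exact ⟨c₂, hc₂p, fun j i hi => by simpa using! hc₂ j ⟨i, hi⟩⟩

theorem consistentWith_of_forall_lt {A : Set M} {m : ℕ} {p : Set (L[[A]].Formula (Fin m))}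
    {J : Type*} [Finite J] {l : J → ℕ} {b : ∀ j, ℕ → Fin (l j) → M}
    {φ : ∀ j, L.Formula (Fin (l j) ⊕ Fin m)} {η : J → ℕ}
    (h : ∀ p₀ ⊆ p, p₀.Finite → ∀ N : ℕ, ∃ c : Fin m → M, Realizes p₀ c ∧
      ∀ j, ∀ i < N, (Holds (φ j) (b j i) c ↔ i = η j)) :
    ConsistentWith p ({S | ∃ j, S = {c | Holds (φ j) (b j (η j)) c}} ∪
      {S | ∃ j i, i ≠ η j ∧ S = {c | ¬ Holds (φ j) (b j i) c}}) := by
  intro p₀ hp₀ hfin Γ₀ hΓ₀ hΓfin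
  have hN : ∀ S : Set (Fin m → M), S ∈ Γ₀ → ∃ N : ℕ, ∀ c : Fin m → M,
      (∀ j, ∀ i < N, (Holds (φ j) (b j i) c ↔ i = η j)) → c ∈ S := by
    intro S hS
    rcases hΓ₀ hS with ⟨j, rfl⟩ | ⟨j, i, hi, rfl⟩
    · exact ⟨η j + 1, fun c hc => (hc j (η j) (Nat.lt_succ_self _)).2 rfl⟩
    · exact ⟨i + 1, fun c hc hh => hi ((hc j i (Nat.lt_succ_self _)).1 hh)⟩
  choose! N hN using hN
  obtain ⟨c, hcp, hc⟩ := h p₀ hp₀ hfin (hΓfin.toFinset.sup N)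
  refine ⟨c, hcp, fun S hS => hN S hS c fun j i hi => hc j i (hi.trans_le ?_)⟩
  exact Finset.le_sup (by simpa using hS)

/-- The formula `φ(x₀, y) xor φ(x₁, y)`. -/
def changeFormula {l m : ℕ} (φ : L.Formula (Fin l ⊕ Fin m)) : L.Formula (Fin (l + l) ⊕ Fin m) :=
  let φ₀ := φ.relabel (Sum.map (Fin.castAdd l) id)
  let φ₁ := φ.relabel (Sum.map (Fin.natAdd l) id)
  ((φ₀ ⊔ φ₁).not ⊔ (φ₀.not ⊔ φ₁.not).not).not

theorem BooleanClosed.changeFormula_mem {m : ℕ} {Δ : ∀ l : ℕ, Set (L.Formula (Fin l ⊕ Fin m))}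
    (hΔ : BooleanClosed Δ) {l : ℕ} {φ : L.Formula (Fin l ⊕ Fin m)} (hφ : φ ∈ Δ l) :
    changeFormula φ ∈ Δ (l + l) := by
  have h₀ := hΔ.rename_mem (Fin.castAdd l) (Fin.castAdd_injective l l) hφ
  have h₁ := hΔ.rename_mem (Fin.natAdd l) (Fin.natAdd_injective l l) hφ
  exact hΔ.not_mem (hΔ.sup_mem (hΔ.not_mem (hΔ.sup_mem h₀ h₁))
    (hΔ.not_mem (hΔ.sup_mem (hΔ.not_mem h₀) (hΔ.not_mem h₁))))

theorem holds_relabel {l l' m : ℕ} (φ : L.Formula (Fin l ⊕ Fin m)) (f : Fin l → Fin l')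
    (b : Fin l' → M) (c : Fin m → M) :
    Holds (φ.relabel (Sum.map f id)) b c ↔ Holds φ (fun t => b (f t)) c := by
  unfold Holds
  rw [Language.Formula.realize_relabel, iff_eq_eq]
  congr 1
  ext x
  rcases x with x | x <;> rfl

theorem holds_changeFormula {l m : ℕ} (φ : L.Formula (Fin l ⊕ Fin m)) (b : Fin (l + l) → M)
    (c : Fin m → M) : Holds (changeFormula φ) b c ↔
      ¬ (Holds φ (fun t => b (Fin.castAdd l t)) c ↔ Holds φ (fun t => b (Fin.natAdd l t)) c) := by
  rw [← holds_relabel φ (Fin.castAdd l), ← holds_relabel φ (Fin.natAdd l)]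
  have key : ∀ (φ₀ φ₁ : L.Formula (Fin (l + l) ⊕ Fin m)) (v : Fin (l + l) ⊕ Fin m → M),
      ((φ₀ ⊔ φ₁).not ⊔ (φ₀.not ⊔ φ₁.not).not).not.Realize v ↔
        ¬ (φ₀.Realize v ↔ φ₁.Realize v) := by
    intro φ₀ φ₁ v
    simp only [Language.Formula.realize_not, Language.Formula.realize_sup]
    by_cases h₀ : φ₀.Realize v <;> by_cases h₁ : φ₁.Realize v <;> simp [h₀, h₁]
  exact key _ _ _

/-- On blocks of two consecutive terms, `changeFormula (φ j)` says that `φ j` changes inside the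
block, which `exists_change_iff` allows to happen at the prescribed block only. -/
theorem ArrayIndiscernible.hasRandomnessPatternIn {A : Set M} {m : ℕ}
    {p : Set (L[[A]].Formula (Fin m))} {Δ : ∀ l : ℕ, Set (L.Formula (Fin l ⊕ Fin m))}
    (hΔ : BooleanClosed Δ) {k : ℕ} {l : Fin k → ℕ} {d : ∀ j, ℕ → Fin (l j) → M}
    (h : ArrayIndiscernible L A d) {φ : ∀ j, L.Formula (Fin (l j) ⊕ Fin m)}
    (hφ : ∀ j, φ j ∈ Δ (l j)) (hd : ChangeConsistent p d (fun j => {v | (φ j).Realize v})) :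
    HasRandomnessPatternIn p Δ k := by
  obtain ⟨b, hb, hb₀, hb₁⟩ : ∃ b : ∀ j, ℕ → Fin (l j + l j) → M, ArrayIndiscernible L A b ∧
      (∀ j i, (fun t => b j i (Fin.castAdd (l j) t)) = d j (2 * i)) ∧
      ∀ j i, (fun t => b j i (Fin.natAdd (l j) t)) = d j (2 * i + 1) :=
    ⟨_, h.blocks (T' := fun j => Fin (l j + l j)) (fun _ => 2) (by simp)
      (fun j => Fin.addCases (fun t => Sum.inr (0, t)) (fun t => Sum.inr (1, t))),
      by simp, by simp only [Fin.addCases_right]; exact fun _ _ => rfl⟩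
  refine ⟨_, b, fun j => changeFormula (φ j), fun j => hΔ.changeFormula_mem (hφ j),
    hb.mutuallyIndiscernible, fun η => ?_⟩
  refine consistentWith_of_forall_lt (b := b) (φ := fun j => changeFormula (φ j))
    (fun p₀ hp₀ hfin N => ?_)
  obtain ⟨c, hc, hcN⟩ := h.exists_change_iff (fun j => definable_holds (φ j)) hd η N hp₀ hfin
  refine ⟨c, hc, fun j i hi => ?_⟩
  rw [holds_changeFormula, ← hcN j i hi, hb₀, hb₁]
  rfl

end Patterns

/-! ### Producing arrays from indiscernible sequences -/

section Stretching

variable {L : FirstOrder.Language.{u, v}} {M : Type w} [L.Structure M]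

/-- An infinite linear order may lack an infinite increasing sequence, so increasing runs of each
finite length serve as approximations. -/
theorem exists_strictMonoOn_Iio (ι : Type*) [LinearOrder ι] [Infinite ι] (N : ℕ) :
    ∃ f : ℕ → ι, StrictMonoOn f (Set.Iio N) := by
  obtain ⟨t, ht⟩ := Infinite.exists_subset_card_eq ι N
  refine ⟨fun i => if h : i < N then t.orderEmbOfFin ht ⟨i, h⟩ else Classical.arbitrary ι, ?_⟩
  intro x hx y hy hxy
  simp only [Set.mem_Iio] at hx hy
  simp only [hx, hy, dif_pos]
  exact (t.orderEmbOfFin ht).strictMono hxy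

theorem divNat_mul_add_lt {k n N : ℕ} {e : Fin k → Fin n → ℕ} (heN : ∀ j r, e j r < N)
    (x : Fin (k * n)) : x.divNat * N + e x.divNat x.modNat < k * N := by
  have h1 := heN x.divNat x.modNat
  have h2 : ((x.divNat : ℕ) + 1) * N ≤ k * N := Nat.mul_le_mul_right _ x.divNat.2
  rw [add_mul, one_mul] at h2
  omega

/-- Index layout for stretching: `k` groups of `n` indices, the `j`-th placed inside the segment
`[jN, (j + 1)N)`. -/
theorem strictMono_divNat_mul_add {k n N : ℕ} {e : Fin k → Fin n → ℕ}
    (he : ∀ j, StrictMono (e j)) (heN : ∀ j r, e j r < N) :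
    StrictMono (fun x : Fin (k * n) => x.divNat * N + e x.divNat x.modNat) := by
  intro x y hxy
  have hx := Nat.div_add_mod (x : ℕ) n
  have hy := Nat.div_add_mod (y : ℕ) n
  have hle : (x : ℕ) / n ≤ y / n := Nat.div_le_div_right hxy.le
  rcases hle.lt_or_eq with hlt | heq
  · have h1 := heN x.divNat x.modNat
    have h2 : ((x.divNat : ℕ) + 1) * N ≤ y.divNat * N := Nat.mul_le_mul_right _ hlt
    rw [add_mul, one_mul] at h2
    simp only
    omega
  · have h1 : x.divNat = y.divNat := Fin.ext heq
    have h2 : x.modNat < y.modNat := by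
      change (x : ℕ) % n < y % n
      rw [heq] at hx
      have : (x : ℕ) < y := hxy
      omega
    simp only [h1]
    exact Nat.add_lt_add_left (he _ h2) _

/-- If `φ` changes its truth value on `k` disjoint pairs of terms of an indiscernible sequence, then
there is a randomness pattern of depth `k`. -/
theorem Indiscernible.hasRandomnessPatternIn {κ : Cardinal.{w}} (hκ : ℵ₀ < κ)
    (hM : IsSaturated L M κ) {A : Set M} (hA : #A < κ) [Nonempty M] {m : ℕ}
    {p : Set (L[[A]].Formula (Fin m))} {Δ : ∀ l : ℕ, Set (L.Formula (Fin l ⊕ Fin m))}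
    (hΔ : BooleanClosed Δ) {k : ℕ} {ι : Type*} [LinearOrder ι] [Infinite ι] {l : ℕ}
    {a : ι → Fin l → M} (ha : Indiscernible L A a) {φ : L.Formula (Fin l ⊕ Fin m)} (hφ : φ ∈ Δ l)
    {s : Fin (k * 2) → ι} (hs : StrictMono s)
    (hc : ∀ p₀ ⊆ p, p₀.Finite → ∃ c : Fin m → M, Realizes p₀ c ∧ ∀ j : Fin k,
      ¬ (Holds φ (a (s (finProdFinEquiv (j, 0)))) c ↔
        Holds φ (a (s (finProdFinEquiv (j, 1)))) c)) :
    HasRandomnessPatternIn p Δ k := by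
  choose ε hε using fun N : ℕ => exists_strictMonoOn_Iio ι (k * N)
  have hmono : ∀ (n N : ℕ) (e : Fin k → Fin n → ℕ), (∀ j, StrictMono (e j)) →
      (∀ j r, e j r < N) →
      StrictMono (fun x : Fin (k * n) => ε N (x.divNat * N + e x.divNat x.modNat)) :=
    fun n N e he heN x y hxy => hε N (divNat_mul_add_lt heN x) (divNat_mul_add_lt heN y)
      (strictMono_divNat_mul_add he heN hxy)
  have hdm : ∀ {n : ℕ} (j : Fin k) (r : Fin n), (finProdFinEquiv (j, r)).divNat = j ∧
      (finProdFinEquiv (j, r)).modNat = r := fun j r => by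
    have := finProdFinEquiv.symm_apply_apply (j, r)
    exact ⟨congrArg Prod.fst this, congrArg Prod.snd this⟩
  -- In the `N`-th approximation an increasing run of `k * N` terms is cut into `k` segments of
  -- length `N`, and row `j` starts with the `j`-th segment.
  obtain ⟨d, hd, hdD⟩ := exists_arrayIndiscernible hκ hM hA
    (fun N (j : Fin k) i (t : Fin l) => a (ε N (j * N + i)) t) (by
      intro n D hD e e' he he'
      have h1 : ∀ e : Fin k → Fin n → ℕ, ∀ᶠ N in Filter.atTop, ∀ j r, e j r < N := fun e =>
        Filter.eventually_all.2 fun j => Filter.eventually_all.2 fun r =>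
          Filter.eventually_gt_atTop _
      filter_upwards [h1 e, h1 e'] with N hN hN'
      have := ha.mem_iff (hD.preimage_comp (fun v : Σ _ : Fin k, Fin n × Fin l =>
        (finProdFinEquiv (v.1, v.2.1), v.2.2))) (hmono n N e he hN) (hmono n N e' he' hN')
      simpa only [Set.mem_preimage, Function.comp_def, hdm] using this)
  refine hd.hasRandomnessPatternIn hΔ (φ := fun _ => φ) (fun _ => hφ) fun p₀ hp₀ hfin => ?_
  have hdef := (definable_realizes_inter_changes hfin (J := Fin k) (T := fun _ => Fin l)
    (fun _ => definable_holds (A := A) φ)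
    (I := Unit) (V := Σ _ : Fin k, ℕ × Fin l) (fun j _ t => ⟨j, 0, t⟩) (fun j _ t => ⟨j, 1, t⟩)
    (fun _ _ => True)).exists_of_finite
  have hmem := hdD _ hdef (by
    filter_upwards [Filter.eventually_ge_atTop 2] with N hN
    obtain ⟨c, hcp, hc⟩ := hc p₀ hp₀ hfin
    have hm := hmono 2 N (fun _ r => r) (fun _ => Fin.val_strictMono)
      (fun _ r => r.2.trans_le hN)
    -- The `2k` given terms have the same order type as the first two terms of each segment, so the
    -- consistent change moves there.
    have := (ha.mem_iff (hdef.preimage_comp (fun v : Σ _ : Fin k, ℕ × Fin l =>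
      (finProdFinEquiv (v.1, if v.2.1 = 0 then (0 : Fin 2) else 1), v.2.2))) hs hm).1
        ⟨c, hcp, fun j _ => by simpa using! hc j⟩
    obtain ⟨c', hcp', hc'⟩ := this
    refine ⟨c', hcp', fun j _ => ?_⟩
    have := hc' j ()
    have hj : (1 + 2 * (j : ℕ)) / 2 = j := by omega
    simpa [hdm, Function.comp_def, hj] using! this)
  obtain ⟨c, hcp, hc⟩ := hmem
  exact ⟨c, hcp, fun j => by simpa using! hc j ()⟩

/-- The formulas of a pattern carry no parameters, so the finitely many parameters from `A` that
occur are made part of the tuple `x`; `τ` fills them in. -/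
theorem exists_formula_of_definable {A : Set M} {T : Type*} [Finite T] {m : ℕ}
    {E : Set (T ⊕ Fin m → M)} (hE : A.Definable L E) :
    ∃ (l : ℕ) (τ : Fin l → A ⊕ T) (φ : L.Formula (Fin l ⊕ Fin m)), ∀ (z : T → M) (c : Fin m → M),
      Sum.elim z c ∈ E ↔ Holds φ (fun t => Sum.elim (fun q : A => (q : M)) z (τ t)) c := by
  classical
  rw [Set.definable_iff_exists_formula_sum] at hE
  obtain ⟨φ, rfl⟩ := hE
  obtain ⟨l, ⟨e⟩⟩ := Finite.exists_equiv_fin (φ.freeVarFinset.toLeft ⊕ T)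
  let f : φ.freeVarFinset → Fin l ⊕ Fin m := fun x => match x with
    | ⟨Sum.inl q, hq⟩ => Sum.inl (e (Sum.inl ⟨q, by simpa using hq⟩))
    | ⟨Sum.inr (Sum.inl t), _⟩ => Sum.inl (e (Sum.inr t))
    | ⟨Sum.inr (Sum.inr y), _⟩ => Sum.inr y
  refine ⟨l, fun t => Sum.map Subtype.val id (e.symm t), φ.restrictFreeVar f, fun z c => ?_⟩
  refine (Language.BoundedFormula.realize_restrictFreeVar
    (Sum.elim (fun q : A => (q : M)) (Sum.elim z c)) ?_).symm
  rintro ⟨q | t | y, h⟩ <;> simp [f]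

/-- A sequence that is not indiscernible over `A ∪ c` contains two increasing tuples that are
distinguished by an `A`-definable relation with parameters `c`. -/
theorem exists_definable_of_not_indiscernible {A : Set M} {m : ℕ} {c : Fin m → M} {ι : Type*}
    [LinearOrder ι] {l : ℕ} {a : ι → Fin l → M} (h : ¬ Indiscernible L (A ∪ Set.range c) a) :
    ∃ (n : ℕ) (E : Set ((Fin n × Fin l) ⊕ Fin m → M)) (i i' : Fin n → ι), 0 < n ∧
      A.Definable L E ∧ StrictMono i ∧ StrictMono i' ∧
      ¬ (Sum.elim (fun st => a (i st.1) st.2) c ∈ E ↔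
        Sum.elim (fun st => a (i' st.1) st.2) c ∈ E) := by
  simp only [Indiscernible, not_forall] at h
  obtain ⟨n, ψ, i, i', hi, hi', hψ⟩ := h
  have hn : 0 < n := by
    rcases Nat.eq_zero_or_pos n with rfl | hn
    · rw [Subsingleton.elim i i'] at hψ
      exact absurd Iff.rfl hψ
    · exact hn
  choose f hf using fun x : Set.range c => x.2
  obtain ⟨E, hE, hEψ⟩ := exists_definable_of_parameters (D := {z | ψ.Realize z}) ⟨ψ, rfl⟩ f
  refine ⟨n, _, i, i', hn, hE.preimage_comp Sum.swap, hi, hi', ?_⟩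
  have key : ∀ z : Fin n × Fin l → M, Sum.elim z c ∘ Sum.swap ∈ E ↔ ψ.Realize z := fun z => by
    rw [← show Sum.elim c z = Sum.elim z c ∘ Sum.swap by ext (x | x) <;> rfl]
    exact hEψ c hf z
  simpa only [Set.mem_preimage, key] using hψ

/-- Transfer to an array requires the same number `r` of indices in every row, so the supports of `i
j` and `i' j` are padded to a common size. -/
theorem exists_strictMono_common {J : Type*} [Finite J] {ι : J → Type*} [∀ j, LinearOrder (ι j)]
    [∀ j, Infinite (ι j)] {n : J → ℕ} {i i' : ∀ j, Fin (n j) → ι j} (hi : ∀ j, StrictMono (i j))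
    (hi' : ∀ j, StrictMono (i' j)) :
    ∃ (r : ℕ) (ε : ∀ j, Fin r → ι j) (α β : ∀ j, Fin (n j) → Fin r), (∀ j, StrictMono (ε j)) ∧
      (∀ j, StrictMono (α j)) ∧ (∀ j, StrictMono (β j)) ∧ (∀ j x, i j x = ε j (α j x)) ∧
      ∀ j x, i' j x = ε j (β j x) := by
  classical
  cases nonempty_fintype J
  let r := ∑ j, (n j + n j)
  have hS : ∀ j, ∃ S : Finset (ι j),
      Finset.univ.image (i j) ∪ Finset.univ.image (i' j) ⊆ S ∧ S.card = r := by
    intro j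
    refine Infinite.exists_superset_card_eq _ _ ?_
    calc _ ≤ n j + n j := (Finset.card_union_le _ _).trans
          (add_le_add (Finset.card_image_le.trans (by simp)) (Finset.card_image_le.trans (by simp)))
      _ ≤ r := Finset.single_le_sum (f := fun j => n j + n j) (fun _ _ => Nat.zero_le _)
          (Finset.mem_univ j)
  choose S hsub hcard using hS
  have hmem : ∀ j x, x ∈ S j → ∃ y : Fin r, x = (S j).orderEmbOfFin (hcard j) y := by
    intro j x hx
    have : x ∈ Set.range ((S j).orderEmbOfFin (hcard j)) := by
      rw [Finset.range_orderEmbOfFin]; exact hx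
    obtain ⟨y, hy⟩ := this
    exact ⟨y, hy.symm⟩
  choose α hα using fun j (x : Fin (n j)) => hmem j (i j x) (hsub j (by simp))
  choose β hβ using fun j (x : Fin (n j)) => hmem j (i' j x) (hsub j (by simp))
  refine ⟨r, fun j => (S j).orderEmbOfFin (hcard j), α, β, fun j => OrderEmbedding.strictMono _,
    fun j x y hxy => ?_, fun j x y hxy => ?_, hα, hβ⟩
  · rw [← ((S j).orderEmbOfFin (hcard j)).lt_iff_lt, ← hα, ← hα]
    exact hi j hxy
  · rw [← ((S j).orderEmbOfFin (hcard j)).lt_iff_lt, ← hβ, ← hβ]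
    exact hi' j hxy

/-- Replaces arbitrary infinite index orders by `ω` while keeping the type over `A` of increasing
tuples. -/
theorem MutuallyIndiscernible.exists_arrayIndiscernible {κ : Cardinal.{w}} (hκ : ℵ₀ < κ)
    (hM : IsSaturated L M κ) {A : Set M} (hA : #A < κ) [Nonempty M] {J : Type*} [Finite J]
    {ι : J → Type*} [∀ j, LinearOrder (ι j)] [∀ j, Infinite (ι j)] {l : J → ℕ}
    {a : ∀ j, ι j → Fin (l j) → M} (ha : MutuallyIndiscernible L A a) :
    ∃ d : ∀ j, ℕ → Fin (l j) → M, ArrayIndiscernible L A d ∧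
      ∀ (r : ℕ) (D : Set ((Σ j, Fin r × Fin (l j)) → M)), A.Definable L D →
        ∀ ε : ∀ j, Fin r → ι j, (∀ j, StrictMono (ε j)) →
        (fun v : Σ j, Fin r × Fin (l j) => a v.1 (ε v.1 v.2.1) v.2.2) ∈ D →
        (fun v : Σ j, Fin r × Fin (l j) => d v.1 v.2.1 v.2.2) ∈ D := by
  choose f hf using fun (N : ℕ) (j : J) => exists_strictMonoOn_Iio (ι j) N
  obtain ⟨d, hd, hdD⟩ := DpRank.exists_arrayIndiscernible hκ hM hA
    (fun N j i t => a j (f N j i) t) (by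
      intro n D hD e e' he he'
      have h1 : ∀ e : J → Fin n → ℕ, ∀ᶠ N in Filter.atTop, ∀ j r, e j r < N := fun e =>
        Filter.eventually_all.2 fun j => Filter.eventually_all.2 fun r =>
          Filter.eventually_gt_atTop _
      filter_upwards [h1 e, h1 e'] with N hN hN'
      exact ha.mem_iff hD (fun j x y hxy => hf N j (hN j x) (hN j y) (he j hxy))
        (fun j x y hxy => hf N j (hN' j x) (hN' j y) (he' j hxy)))
  refine ⟨d, hd, fun r D hD ε hε haD => hdD _ (hD.preimage_comp
    (fun v : Σ j, Fin r × Fin (l j) => (⟨v.1, v.2.1, v.2.2⟩ : Σ j, ℕ × Fin (l j)))) ?_⟩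
  filter_upwards [Filter.eventually_ge_atTop r] with N hN
  exact (ha.mem_iff hD hε (fun j x y hxy => hf N j (x.2.trans_le hN) (y.2.trans_le hN) hxy)).1 haD

theorem ArrayIndiscernible.exists_consecutive_change {A : Set M} {m : ℕ} {J : Type*} [Finite J]
    {l : J → ℕ} {d : ∀ j, ℕ → Fin (l j) → M} (hd : ArrayIndiscernible L A d) {n : J → ℕ}
    {E : ∀ j, Set ((Fin (n j) × Fin (l j)) ⊕ Fin m → M)} (hE : ∀ j, A.Definable L (E j)) {r : ℕ}
    {α β : ∀ j, Fin (n j) → Fin r} (hα : ∀ j, StrictMono (α j)) (hβ : ∀ j, StrictMono (β j))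
    {p₀ : Set (L[[A]].Formula (Fin m))} (hfin : p₀.Finite) {c : Fin m → M} (hc : Realizes p₀ c)
    (hαβ : ∀ j, ¬ (Sum.elim (fun st => d j (α j st.1) st.2) c ∈ E j ↔
      Sum.elim (fun st => d j (β j st.1) st.2) c ∈ E j)) :
    ∃ c' : Fin m → M, Realizes p₀ c' ∧ ∀ j,
      ¬ (Sum.elim (fun st : Fin (n j) × Fin (l j) => d j st.1 st.2) c' ∈ E j ↔
        Sum.elim (fun st : Fin (n j) × Fin (l j) => d j (n j + st.1) st.2) c' ∈ E j) := by
  -- A third tuple to the right of both differs in truth value from at least one of them. This gives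
  -- a changing pair of tuples that do not interleave.
  have hδ : ∀ j, ∃ δ : Fin (n j) → Fin r, StrictMono δ ∧
      ¬ (Sum.elim (fun st => d j (δ st.1) st.2) c ∈ E j ↔
        Sum.elim (fun st : Fin (n j) × Fin (l j) => d j (r + st.1) st.2) c ∈ E j) := by
    intro j
    have := hαβ j
    by_cases h : (Sum.elim (fun st => d j (α j st.1) st.2) c ∈ E j ↔
        Sum.elim (fun st : Fin (n j) × Fin (l j) => d j (r + st.1) st.2) c ∈ E j)
    · exact ⟨β j, hβ j, by tauto⟩
    · exact ⟨α j, hα j, h⟩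
  choose δ hδ hδE using hδ
  -- A subsequence whose first two blocks of length `n j` are the two tuples of this pair.
  have he : ∀ j, ∃ e : ℕ → ℕ, StrictMono e ∧ (∀ x : Fin (n j), e x = δ j x) ∧
      ∀ x : Fin (n j), e (n j + x) = r + x := by
    intro j
    obtain ⟨e, he, hex⟩ := exists_strictMono_extend (n := n j + n j)
      (Fin.addCases (fun x => (δ j x : ℕ)) (fun x => r + x)) (by
        intro x y hxy
        induction x using Fin.addCases with
        | left x =>
          induction y using Fin.addCases with
          | left y =>
            simp only [Fin.addCases_left]
            exact hδ j (Fin.lt_def.2 (Fin.lt_def.1 hxy))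
          | right y =>
            simp only [Fin.addCases_left, Fin.addCases_right]
            omega
        | right x =>
          induction y using Fin.addCases with
          | left y =>
            simp only [Fin.lt_def, Fin.val_castAdd, Fin.val_natAdd] at hxy
            omega
          | right y =>
            simp only [Fin.lt_def, Fin.val_natAdd] at hxy
            simp only [Fin.addCases_right]
            omega)
    refine ⟨e, he, fun x => ?_, fun x => ?_⟩
    · simpa only [Fin.addCases_left, Fin.val_castAdd] using hex (Fin.castAdd (n j) x)
    · simpa only [Fin.addCases_right, Fin.val_natAdd] using hex (Fin.natAdd (n j) x)
  choose e he heδ her using he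
  obtain ⟨c', hc', hcE⟩ := hd.exists_mem (definable_realizes_inter_changes hfin hE
      (I := Unit) (fun j _ st => ⟨j, st.1, st.2⟩) (fun j _ st => ⟨j, n j + st.1, st.2⟩)
      (fun _ _ => True)) (e := e) (e' := fun _ x => x) he (fun _ => strictMono_id)
      ⟨c, hc, fun j _ => by
        have := hδE j
        simp only [← heδ, ← her] at this
        exact iff_true_intro this⟩
  exact ⟨c', hc', fun j => (hcE j ()).2 trivial⟩

theorem booleanClosed_univ (L : FirstOrder.Language.{u, v}) (m : ℕ) :
    BooleanClosed (L := L) (m := m) (fun _ => Set.univ) :=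
  ⟨⟨0, ⊥, trivial⟩, fun _ => trivial, fun _ _ => trivial, fun _ _ _ _ => trivial⟩

theorem hasRandomnessPatternIn_univ {A : Set M} {m : ℕ} {p : Set (L[[A]].Formula (Fin m))}
    {k : ℕ} : HasRandomnessPatternIn p (fun _ => Set.univ) k ↔ HasRandomnessPattern p k :=
  ⟨fun ⟨l, b, φ, _, h⟩ => ⟨l, b, φ, h⟩, fun ⟨l, b, φ, h⟩ => ⟨l, b, φ, fun _ => trivial, h⟩⟩

theorem MutuallyIndiscernible.hasRandomnessPattern {κ : Cardinal.{w}} (hκ : ℵ₀ < κ)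
    (hM : IsSaturated L M κ) {A : Set M} (hA : #A < κ) [Nonempty M] {m : ℕ}
    {p : Set (L[[A]].Formula (Fin m))} {k : ℕ} {ι : Fin k → Type*} [∀ j, LinearOrder (ι j)]
    [∀ j, Infinite (ι j)] {l : Fin k → ℕ} {a : ∀ j, ι j → Fin (l j) → M}
    (ha : MutuallyIndiscernible L A a) {c : Fin m → M} (hc : Realizes p c)
    (hn : ∀ j, ¬ Indiscernible L (A ∪ Set.range c) (a j)) : HasRandomnessPattern p k := by
  choose n E i i' hpos hE hi hi' hii' using fun j => exists_definable_of_not_indiscernible (hn j)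
  obtain ⟨r, ε, α, β, hε, hα, hβ, hiα, hiβ⟩ := exists_strictMono_common hi hi'
  obtain ⟨d, hd, hdD⟩ := ha.exists_arrayIndiscernible hκ hM hA
  choose l' τ φ hφ using fun j => exists_formula_of_definable (hE j)
  rw [← hasRandomnessPatternIn_univ]
  have hΔ := booleanClosed_univ L m
  -- Each block of `n j` terms, completed by parameters from `A`, becomes one term, so a change
  -- between the first two blocks is a change between the first two terms.
  refine (hd.blocks n hpos τ).hasRandomnessPatternIn hΔ (φ := φ) (fun _ => trivial)
    fun p₀ hp₀ hfin => ?_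
  obtain ⟨c₁, hc₁, hE₁⟩ := hdD r _ (definable_realizes_inter_changes hfin hE
      (I := Unit) (fun j _ st => ⟨j, α j st.1, st.2⟩) (fun j _ st => ⟨j, β j st.1, st.2⟩)
      (fun _ _ => True)).exists_of_finite ε hε
      ⟨c, fun ψ hψ => hc ψ (hp₀ hψ), fun j _ => by simpa [hiα, hiβ] using! hii' j⟩
  obtain ⟨c₂, hc₂, hE₂⟩ := hd.exists_consecutive_change hE hα hβ hfin hc₁
    fun j => by simpa using! hE₁ j ()
  refine ⟨c₂, hc₂, fun j => ?_⟩
  have := hE₂ j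
  rw [hφ, hφ] at this
  simpa [Holds] using this

end Stretching

/-! ### Realizing patterns; dp-rank, cutting and alternation -/

section Realization

variable {L : FirstOrder.Language.{u, v}} {M : Type w} [L.Structure M]

theorem ConsistentWith.exists_realizes {κ : Cardinal.{w}} (hM : IsSaturated L M κ) {A B : Set M}
    (hAB : A ⊆ B) (hB : #B < κ) {m : ℕ} {p : Set (L[[A]].Formula (Fin m))}
    {Γ : Set (Set (Fin m → M))} (hΓ : ∀ S ∈ Γ, B.Definable L S) (h : ConsistentWith p Γ) :
    ∃ c : Fin m → M, Realizes p c ∧ ∀ S ∈ Γ, c ∈ S := by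
  obtain ⟨c, hc⟩ := hM.exists_mem hB
    ((fun ψ : L[[A]].Formula (Fin m) => {c | ψ.Realize c}) '' p ∪ Γ) (by
      rintro S (⟨ψ, -, rfl⟩ | hS)
      · exact Set.Definable.mono ⟨ψ, rfl⟩ hAB
      · exact hΓ S hS) (by
      intro F₀ hF₀ hfin
      let f : L[[A]].Formula (Fin m) → Set (Fin m → M) := fun ψ => {c | ψ.Realize c}
      obtain ⟨p₀, hp₀, hp₀fin, hF⟩ := Set.exists_subset_image_finite_and.1
        (⟨F₀ ∩ f '' p, Set.inter_subset_right, hfin.subset Set.inter_subset_left, rfl⟩ :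
          ∃ t ⊆ f '' p, t.Finite ∧ t = F₀ ∩ f '' p)
      obtain ⟨c, hcp, hc⟩ := h p₀ hp₀ hp₀fin (F₀ ∩ Γ) Set.inter_subset_right
        (hfin.subset Set.inter_subset_left)
      refine ⟨c, fun S hS => ?_⟩
      rcases hF₀ hS with hS' | hS'
      · have : S ∈ f '' p₀ := by
          rw [hF]; exact ⟨hS, hS'⟩
        obtain ⟨ψ, hψ, rfl⟩ := this
        exact hcp ψ hψ
      · exact hc S ⟨hS, hS'⟩)
  exact ⟨c, fun ψ hψ => hc _ (Or.inl ⟨ψ, hψ, rfl⟩), fun S hS => hc S (Or.inr hS)⟩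

theorem definable_holds_tuple {l m : ℕ} (φ : L.Formula (Fin l ⊕ Fin m)) {B : Set M}
    (b : Fin l → M) (hb : ∀ t, b t ∈ B) : B.Definable L {c : Fin m → M | Holds φ b c} := by
  convert! definable_subst (Set.empty_subset B) (definable_holds φ)
    (Sum.map (fun t => (⟨b t, hb t⟩ : B)) id) using 1
  ext c
  simp only [Holds, Set.mem_ofPred_eq]
  rw [iff_eq_eq]
  congr 1
  ext x
  rcases x with x | x <;> rfl

/-- A pattern adds only countably many parameters to `A`, fewer than `κ` in total, so saturation
turns the consistency of each `η` into a realization. -/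
theorem IsRandomnessPattern.exists_realizes {κ : Cardinal.{w}} (hκ : ℵ₀ < κ)
    (hM : IsSaturated L M κ) {A : Set M} (hA : #A < κ) {m : ℕ}
    {p : Set (L[[A]].Formula (Fin m))} {J : Type*} [Countable J] {l : J → ℕ}
    {b : ∀ j, ℕ → Fin (l j) → M} {φ : ∀ j, L.Formula (Fin (l j) ⊕ Fin m)}
    (h : IsRandomnessPattern p b φ) (η : J → ℕ) :
    ∃ c : Fin m → M, Realizes p c ∧ ∀ j i, Holds (φ j) (b j i) c ↔ i = η j := by
  let C : Set M := Set.range fun v : Σ j, ℕ × Fin (l j) => b v.1 v.2.1 v.2.2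
  have hC : #C ≤ ℵ₀ := (Set.countable_range _).le_aleph0
  have hmem : ∀ j i t, b j i t ∈ A ∪ C := fun j i t => Or.inr ⟨⟨j, i, t⟩, rfl⟩
  obtain ⟨c, hcp, hc⟩ := (h.2 η).exists_realizes hM (B := A ∪ C) Set.subset_union_left
    ((mk_union_le _ _).trans_lt (add_lt_of_lt hκ.le hA (hC.trans_lt hκ))) (by
      rintro S (⟨j, rfl⟩ | ⟨j, i, -, rfl⟩)
      · exact definable_holds_tuple _ _ (hmem j _)
      · exact (definable_holds_tuple _ _ (hmem j i)).compl)
  refine ⟨c, hcp, fun j i => ⟨fun hh => ?_, ?_⟩⟩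
  · by_contra hi
    exact hc _ (Or.inr ⟨j, i, hi, rfl⟩) hh
  · rintro rfl
    exact hc _ (Or.inl ⟨j, rfl⟩)

theorem BooleanClosed.exists_iSup {m : ℕ} {Δ : ∀ l : ℕ, Set (L.Formula (Fin l ⊕ Fin m))}
    (hΔ : BooleanClosed Δ) {l : ℕ} (hne : (Δ l).Nonempty) {J : Type*} [Finite J]
    {φ : J → L.Formula (Fin l ⊕ Fin m)} (hφ : ∀ j, φ j ∈ Δ l) :
    ∃ ψ ∈ Δ l, ∀ (b : Fin l → M) (c : Fin m → M), Holds ψ b c ↔ ∃ j, Holds (φ j) b c := by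
  classical
  cases nonempty_fintype J
  suffices H : ∀ s : Finset J, ∃ ψ ∈ Δ l, ∀ (b : Fin l → M) (c : Fin m → M),
      Holds ψ b c ↔ ∃ j ∈ s, Holds (φ j) b c by
    simpa using H Finset.univ
  intro s
  induction s using Finset.induction_on with
  | empty =>
    obtain ⟨χ, hχ⟩ := hne
    -- The empty disjunction is built from some `χ` as `¬(χ ∨ ¬χ)`, since `⊥` itself need not lie in
    -- `Δ`.
    exact ⟨_, hΔ.not_mem (hΔ.sup_mem hχ (hΔ.not_mem hχ)), by simp [Holds, em]⟩
  | insert j s _ ih =>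
    obtain ⟨ψ, hψ, h⟩ := ih
    exact ⟨_, hΔ.sup_mem (hφ j) hψ, fun b c => by
      simp only [Finset.mem_insert, exists_eq_or_imp, ← h]
      simp [Holds]⟩

/-- A randomness pattern of depth `k` gives rise to an indiscernible sequence and a formula that
cuts out every set of `k` terms of the sequence. -/
theorem HasRandomnessPatternIn.exists_cut {κ : Cardinal.{w}} (hκ : ℵ₀ < κ)
    (hM : IsSaturated L M κ) {A : Set M} (hA : #A < κ) [Nonempty M] {m : ℕ}
    {p : Set (L[[A]].Formula (Fin m))} {Δ : ∀ l : ℕ, Set (L.Formula (Fin l ⊕ Fin m))}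
    (hΔ : BooleanClosed Δ) {k : ℕ} (h : HasRandomnessPatternIn p Δ k) :
    ∃ (l : ℕ) (φ : L.Formula (Fin l ⊕ Fin m)) (a : ULift.{w} ℕ → Fin l → M), φ ∈ Δ l ∧
      Indiscernible L A a ∧ ∀ I' : Finset (ULift.{w} ℕ), I'.card = k →
        ∃ c : Fin m → M, Realizes p c ∧ ∀ i, Holds φ (a i) c ↔ i ∈ I' := by
  obtain ⟨l, b, φ, hφ, hb⟩ := h
  rcases Nat.eq_zero_or_pos k with rfl | hk
  -- A pattern of depth zero provides no formula. A contradictory formula of `Δ` cuts out the empty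
  -- set from a constant sequence.
  · obtain ⟨l₀, hne⟩ := hΔ.nonempty
    obtain ⟨ψ, hψ, hh⟩ := hΔ.exists_iSup (M := M) (J := Empty) hne (φ := Empty.elim)
      (fun j => j.elim)
    refine ⟨l₀, ψ, fun _ _ => Classical.arbitrary M, hψ, fun n ψ i j _ _ => Iff.rfl,
      fun I' hI' => ?_⟩
    obtain ⟨c, hc, -⟩ := hb.exists_realizes hκ hM hA (fun _ => 0)
    refine ⟨c, hc, fun i => ?_⟩
    rw [hh, Finset.card_eq_zero.1 hI']
    simp
  -- The `i`-th terms of all rows are concatenated into one tuple, and `ψ` is the disjunction of the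
  -- `φ j`, each reading its own part.
  · let f : ∀ j, Fin (l j) → Fin (∑ j, l j) := fun j t => finSigmaFinEquiv ⟨j, t⟩
    have hf : ∀ j, Function.Injective (f j) := fun j x y hxy => by
      simpa using finSigmaFinEquiv.injective hxy
    have hmem := fun j => hΔ.rename_mem (f j) (hf j) (hφ j)
    obtain ⟨ψ, hψ, hh⟩ := hΔ.exists_iSup (M := M) ⟨_, hmem ⟨0, hk⟩⟩ hmem
    let B : ℕ → (Σ j, Fin (l j)) → M := fun i v => b v.1 i v.2
    refine ⟨_, ψ, fun i x => B i.down (finSigmaFinEquiv.symm x), hψ, ?_, fun I' hI' => ?_⟩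
    · intro n χ i j hi hj
      obtain ⟨g, hg, hgi⟩ := exists_strictMono_extend (fun x => (i x).down) fun x y hxy => hi hxy
      obtain ⟨g', hg', hgj⟩ := exists_strictMono_extend (fun x => (j x).down) fun x y hxy => hj hxy
      have hχ : A.Definable L {z | χ.Realize z} := ⟨χ, rfl⟩
      have := hb.1.arrayIndiscernible _ (hχ.preimage_comp
        (fun st : Fin n × Fin (∑ j, l j) => (⟨(finSigmaFinEquiv.symm st.2).1, st.1,
          (finSigmaFinEquiv.symm st.2).2⟩ : Σ j, ℕ × Fin (l j)))) (fun _ => g) (fun _ => g')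
          (fun _ => hg) (fun _ => hg')
      simp only [Set.mem_preimage, Function.comp_def, hgi, hgj] at this
      exact this
    -- Here `η j` is the `j`-th element of `I'`, so the disjunction holds exactly on `I'`.
    · obtain ⟨c, hc, hcb⟩ := hb.exists_realizes hκ hM hA
        (fun j => (I'.orderEmbOfFin hI' j).down)
      refine ⟨c, hc, fun i => ?_⟩
      have hr : ∀ j, Holds ((φ j).relabel (Sum.map (f j) id))
          (fun x => B i.down (finSigmaFinEquiv.symm x)) c ↔ i = I'.orderEmbOfFin hI' j := by
        intro j
        rw [holds_relabel]
        simp only [f, Equiv.symm_apply_apply]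
        exact (hcb j i.down).trans (ULift.down_inj)
      have hrange : i ∈ I' ↔ i ∈ Set.range (I'.orderEmbOfFin hI') := by
        rw [Finset.range_orderEmbOfFin]; rfl
      rw [hh, hrange]
      simp only [hr, Set.mem_range, eq_comm]

theorem altRankGE_of_cut {A : Set M} {m : ℕ} {p : Set (L[[A]].Formula (Fin m))} {l : ℕ}
    {φ : L.Formula (Fin l ⊕ Fin m)} {ι : Type w} [LinearOrder ι] [Infinite ι] {a : ι → Fin l → M}
    (ha : Indiscernible L A a) {k : ℕ} (h : ∀ I' : Finset ι, I'.card = k →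
      ∃ c : Fin m → M, Realizes p c ∧ ∀ i, Holds φ (a i) c ↔ i ∈ I') : AltRankGE p φ (2 * k) := by
  classical
  obtain ⟨t, ht⟩ := Infinite.exists_subset_card_eq ι (2 * k + 1)
  let s := t.orderEmbOfFin ht
  -- Among `2k + 1` increasing indices, the `k` at odd positions are cut out; each of the `2k`
  -- consecutive steps is then a change.
  obtain ⟨c, hc, hcI⟩ := h (Finset.univ.image fun j : Fin k => s ⟨2 * j + 1, by omega⟩) (by
    rw [Finset.card_image_of_injective _ (fun x y hxy => by
      have := s.injective hxy
      simp only [Fin.mk.injEq] at this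
      omega)]
    simp)
  have hodd : ∀ i : Fin (2 * k + 1), Holds φ (a (s i)) c ↔ (i : ℕ) % 2 = 1 := by
    intro i
    simp only [hcI, Finset.mem_image, Finset.mem_univ, true_and, s.injective.eq_iff]
    constructor
    · rintro ⟨j, rfl⟩
      simp only
      omega
    · intro hi
      exact ⟨⟨i / 2, by omega⟩, Fin.ext (by simp only; omega)⟩
  refine ⟨ι, _, ‹_›, a, ha, c, hc, s, s.strictMono, fun j => ?_⟩
  rw [hodd, hodd, Fin.val_castSucc, Fin.val_succ]
  omega

/-- A realization for `η = 0` separates terms `0` and `1` of every row, so no row is indiscernible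
over `Ac`. If `μ < k`, then `μ` is finite and `1 + μ` of the rows refute `DpRankLE p μ`. -/
theorem HasRandomnessPattern.dpRankGE {κ : Cardinal.{w}} (hκ : ℵ₀ < κ)
    (hM : IsSaturated L M κ) {A : Set M} (hA : #A < κ) {m : ℕ}
    {p : Set (L[[A]].Formula (Fin m))} {k : ℕ} (h : HasRandomnessPattern p k) : DpRankGE p k := by
  intro μ hμ
  by_contra! hlt
  obtain ⟨n, rfl⟩ := lt_aleph0.1 (hlt.trans (natCast_lt_aleph0))
  have hn : 1 + n ≤ k := by
    have := Nat.cast_lt.1 hlt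
    omega
  obtain ⟨l, b, φ, hb⟩ := h
  obtain ⟨c, hc, hcb⟩ := hb.exists_realizes hκ hM hA (fun _ => 0)
  let f : ULift.{w} (Fin (1 + n)) → Fin k := fun j => Fin.castLE hn j.down
  have hf : Function.Injective f := (Fin.castLE_injective hn).comp ULift.down_injective
  obtain ⟨j, hj⟩ := hμ c hc (ULift.{w} (Fin (1 + n))) (by simp) (fun _ => ULift.{w} ℕ)
    (fun j => l (f j)) (fun j i => b (f j) i.down)
    ((hb.1.comp hf).comp_strictMono (ι' := fun _ => ULift.{w} ℕ) (f := fun _ => ULift.down)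
      fun _ _ _ hxy => hxy)
  have hdef : (A ∪ Set.range c).Definable L
      {z : Fin 1 × Fin (l (f j)) → M | Holds (φ (f j)) (fun t => z (0, t)) c} := by
    convert! definable_subst (Set.empty_subset _) (definable_holds (φ (f j)))
      (Sum.elim (fun t => Sum.inr ((0 : Fin 1), t))
        (fun y => Sum.inl (⟨c y, Or.inr ⟨y, rfl⟩⟩ : ↥(A ∪ Set.range c)))) using 1
    ext z
    simp only [Holds, Set.mem_ofPred_eq]
    rw [iff_eq_eq]
    congr 1
    ext x
    rcases x with x | x <;> rfl
  have := hj.mem_iff hdef (i := fun _ => ⟨0⟩) (j := fun _ => ⟨1⟩) (Subsingleton.strictMono _)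
    (Subsingleton.strictMono _)
  simp [hcb] at this

theorem IsPartialType.hasRandomnessPatternIn_zero {A : Set M} {m : ℕ}
    {p : Set (L[[A]].Formula (Fin m))} (hp : IsPartialType p)
    (Δ : ∀ l : ℕ, Set (L.Formula (Fin l ⊕ Fin m))) : HasRandomnessPatternIn p Δ 0 := by
  refine ⟨fun _ => 0, fun j => j.elim0, fun j => j.elim0, fun j => j.elim0, fun j => j.elim0,
    fun η p₀ hp₀ hfin Γ₀ hΓ₀ _ => ?_⟩
  obtain ⟨c, hc⟩ := hp p₀ hp₀ hfin
  refine ⟨c, hc, fun S hS => ?_⟩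
  rcases hΓ₀ hS with ⟨j, -⟩ | ⟨j, -⟩ <;> exact j.elim0

theorem DpRankGE.hasRandomnessPattern {κ : Cardinal.{w}} (hκ : ℵ₀ < κ)
    (hM : IsSaturated L M κ) {A : Set M} (hA : #A < κ) [Nonempty M] {m : ℕ}
    {p : Set (L[[A]].Formula (Fin m))} (hp : IsPartialType p) {k : ℕ} (h : DpRankGE p k) :
    HasRandomnessPattern p k := by
  rcases k with _ | k
  · exact hasRandomnessPatternIn_univ.1 (hp.hasRandomnessPatternIn_zero _)
  · have hnot : ¬ DpRankLE p (k : Cardinal.{w}) := fun hle => by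
      have := Nat.cast_le.1 (h _ hle)
      omega
    simp only [DpRankLE, not_forall, not_exists] at hnot
    obtain ⟨c, hc, J, hJ, ι, _, _, l, a, ha, hn⟩ := hnot
    have hJ' : #J = #(ULift.{w} (Fin (k + 1))) := by
      rw [hJ]; simp [add_comm]
    obtain ⟨e⟩ := Cardinal.eq.1 hJ'
    have hf : Function.Injective (e.symm ∘ ULift.up : Fin (k + 1) → J) :=
      e.symm.injective.comp ULift.up_injective
    exact (ha.comp hf).hasRandomnessPattern hκ hM hA hc fun j => hn _

/-- The alternations from `s (2j)` to `s (2j + 1)`, for `j < k`, are changes on `k` disjoint pairs.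
-/
theorem AltRankGE.hasRandomnessPattern {κ : Cardinal.{w}} (hκ : ℵ₀ < κ)
    (hM : IsSaturated L M κ) {A : Set M} (hA : #A < κ) [Nonempty M] {m : ℕ}
    {p : Set (L[[A]].Formula (Fin m))} {k l : ℕ} {φ : L.Formula (Fin l ⊕ Fin m)}
    (h : AltRankGE p φ (2 * k)) : HasRandomnessPattern p k := by
  obtain ⟨ι, _, _, a, ha, c, hc, s, hs, halt⟩ := h
  rw [← hasRandomnessPatternIn_univ]
  have hΔ := booleanClosed_univ L m
  refine ha.hasRandomnessPatternIn hκ hM hA hΔ (φ := φ) trivial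
    (s := fun x : Fin (k * 2) => s ⟨x, by omega⟩) (fun x y hxy => hs hxy)
    fun p₀ hp₀ _ => ⟨c, fun ψ hψ => hc ψ (hp₀ hψ), fun j => ?_⟩
  have := halt ⟨2 * j, by omega⟩
  convert this using 6 <;> simp [finProdFinEquiv, add_comm]

end Realization

/-! ### Counting types: binary words and density -/

section Density

/-- The greedy number of disjoint pairs of consecutive letters of a binary word at which the word
changes. -/
def changeCount : List Bool → ℕ
  | a :: b :: t => if a = b then changeCount (b :: t) else changeCount t + 1
  | [_] => 0
  | [] => 0

theorem exists_strictMono_of_le_changeCount (w : List Bool) {k : ℕ} (hk : k ≤ changeCount w) :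
    ∃ f : ℕ → ℕ, StrictMono f ∧ ∀ j < k, f (2 * j + 1) < w.length ∧
      w.getD (f (2 * j)) false ≠ w.getD (f (2 * j + 1)) false := by
  induction w using changeCount.induct generalizing k with
  | case1 b t ih =>
    simp only [changeCount, if_true] at hk
    obtain ⟨f, hf, h⟩ := ih hk
    refine ⟨fun x => f x + 1, fun x y hxy => Nat.succ_lt_succ (hf hxy), fun j hj => ?_⟩
    obtain ⟨h1, h2⟩ := h j hj
    exact ⟨by simpa using h1, by simpa using h2⟩
  | case2 a b t hab ih =>
    simp only [changeCount, if_neg hab] at hk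
    obtain ⟨f, hf, h⟩ := ih (k := k - 1) (by omega)
    -- The first pair is the changing pair of initial letters; the later pairs come from the tail,
    -- shifted by two.
    refine ⟨fun x => if x < 2 then x else f (x - 2) + 2, ?_, fun j hj => ?_⟩
    · intro x y hxy
      by_cases hx : x < 2
      · by_cases hy : y < 2
        · simpa [hx, hy] using hxy
        · simp only [hx, hy, if_true, if_false]
          omega
      · have hy : ¬ y < 2 := by omega
        simp only [hx, hy, if_false]
        have := hf (show x - 2 < y - 2 by omega)
        omega
    · rcases j with _ | j
      · simpa using hab
      · obtain ⟨h1, h2⟩ := h j (by omega)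
        have e1 : 2 * (j + 1) - 2 = 2 * j := by omega
        have e2 : 2 * (j + 1) + 1 - 2 = 2 * j + 1 := by omega
        have e3 : ¬ 2 * (j + 1) < 2 := by omega
        have e4 : ¬ 2 * (j + 1) + 1 < 2 := by omega
        simp only [e1, e2, e3, e4, if_false]
        exact ⟨by simpa using h1, by simpa using h2⟩
  | case3 _ =>
    obtain rfl : k = 0 := by simpa [changeCount] using hk
    exact ⟨id, strictMono_id, by simp⟩
  | case4 =>
    obtain rfl : k = 0 := by simpa [changeCount] using hk
    exact ⟨id, strictMono_id, by simp⟩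

theorem finite_changeCount_lt (n k : ℕ) :
    {w : List Bool | w.length = n ∧ changeCount w < k}.Finite :=
  (List.finite_length_eq Bool n).subset fun _ h => h.1

/-- If the first two letters agree, one of them can be dropped without altering the count. If they
differ, both are dropped, the count falls by one, and there are two choices for them. -/
theorem ncard_changeCount_lt_add_two_le (n k : ℕ) :
    {w : List Bool | w.length = n + 2 ∧ changeCount w < k + 1}.ncard ≤
      {w : List Bool | w.length = n + 1 ∧ changeCount w < k + 1}.ncard +
        2 * {w : List Bool | w.length = n ∧ changeCount w < k}.ncard := by
  classical
  have hsub : {w : List Bool | w.length = n + 2 ∧ changeCount w < k + 1} ⊆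
      ((fun w : List Bool => w.headI :: w) ''
        {w : List Bool | w.length = n + 1 ∧ changeCount w < k + 1} ∪
      (fun w : List Bool => false :: true :: w) ''
        {w : List Bool | w.length = n ∧ changeCount w < k}) ∪
      (fun w : List Bool => true :: false :: w) ''
        {w : List Bool | w.length = n ∧ changeCount w < k} := by
    rintro w ⟨hlen, hcount⟩
    match w with
    | [] => simp at hlen
    | [_] => simp at hlen
    | a :: b :: t =>
      simp only [List.length_cons, Nat.add_right_cancel_iff] at hlen
      by_cases hab : a = b
      · subst hab
        simp only [changeCount, if_true] at hcount
        exact Or.inl (Or.inl ⟨a :: t, ⟨by simpa using hlen, hcount⟩, rfl⟩)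
      · simp only [changeCount, if_neg hab] at hcount
        have ht : t ∈ {w : List Bool | w.length = n ∧ changeCount w < k} := ⟨hlen, by omega⟩
        cases a <;> cases b <;> simp at hab
        · exact Or.inl (Or.inr ⟨t, ht, rfl⟩)
        · exact Or.inr ⟨t, ht, rfl⟩
  have h1 := finite_changeCount_lt (n + 1) (k + 1)
  have h2 := finite_changeCount_lt n k
  have hle := Set.ncard_le_ncard hsub (((h1.image _).union (h2.image _)).union (h2.image _))
  refine hle.trans ((Set.ncard_union_le _ _).trans ?_)
  have hu := Set.ncard_union_le ((fun w : List Bool => w.headI :: w) ''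
        {w : List Bool | w.length = n + 1 ∧ changeCount w < k + 1})
      ((fun w : List Bool => false :: true :: w) ''
        {w : List Bool | w.length = n ∧ changeCount w < k})
  have i1 := Set.ncard_image_le (f := fun w : List Bool => w.headI :: w) h1
  have i2 := Set.ncard_image_le (f := fun w : List Bool => false :: true :: w) h2
  have i3 := Set.ncard_image_le (f := fun w : List Bool => true :: false :: w) h2
  omega

/-- Only the degree `k` in `n` matters. The constants are chosen so that the recursion closes: `4(n
+ 2) + 4 = 4(n + 3)`. -/
theorem ncard_changeCount_lt_le (n k : ℕ) :
    {w : List Bool | w.length = n ∧ changeCount w < k + 1}.ncard ≤ 2 * (2 * (n + 1)) ^ k := by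
  induction n using Nat.strong_induction_on generalizing k with
  | _ n ih =>
    match n with
    | 0 =>
      have : {w : List Bool | w.length = 0 ∧ changeCount w < k + 1} ⊆ {[]} := fun w hw =>
        List.length_eq_zero_iff.1 hw.1
      calc _ ≤ ({[]} : Set (List Bool)).ncard := Set.ncard_le_ncard this
        _ = 1 := Set.ncard_singleton _
        _ ≤ _ := Nat.succ_le_of_lt (by positivity)
    | 1 =>
      have : {w : List Bool | w.length = 1 ∧ changeCount w < k + 1} ⊆ {[true], [false]} := by
        rintro w ⟨hw, -⟩
        obtain ⟨a, rfl⟩ := List.length_eq_one_iff.1 hw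
        cases a <;> simp
      calc _ ≤ ({[true], [false]} : Set (List Bool)).ncard := Set.ncard_le_ncard this
        _ ≤ 2 := (Set.ncard_pair (by simp)).le
        _ = 2 * 1 := rfl
        _ ≤ _ := Nat.mul_le_mul_left _ (Nat.one_le_pow _ _ (by positivity))
    | n + 2 =>
      refine (ncard_changeCount_lt_add_two_le n k).trans ?_
      have h1 := ih (n + 1) (by omega) k
      rcases k with _ | k
      · simpa using h1
      · have h2 := ih n (by omega) k
        have h3 : (2 * (n + 1 + 1)) ^ k ≤ (2 * (n + 2 + 1)) ^ k := Nat.pow_le_pow_left (by omega) _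
        have h4 : (2 * (n + 1)) ^ k ≤ (2 * (n + 2 + 1)) ^ k := Nat.pow_le_pow_left (by omega) _
        calc _ ≤ 2 * (2 * (n + 1 + 1)) ^ (k + 1) + 2 * (2 * (2 * (n + 1)) ^ k) :=
              add_le_add h1 (Nat.mul_le_mul_left _ h2)
          _ = (2 * (2 * (n + 1 + 1))) * (2 * (n + 1 + 1)) ^ k + 4 * (2 * (n + 1)) ^ k := by ring
          _ ≤ (2 * (2 * (n + 1 + 1))) * (2 * (n + 2 + 1)) ^ k + 4 * (2 * (n + 2 + 1)) ^ k :=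
              add_le_add (Nat.mul_le_mul_left _ h3) (Nat.mul_le_mul_left _ h4)
          _ = 2 * (2 * (n + 2 + 1)) ^ (k + 1) := by ring

variable {L : FirstOrder.Language.{u, v}} {M : Type w} [L.Structure M]

theorem phiTypes_finite {A : Set M} {m l : ℕ} (p : Set (L[[A]].Formula (Fin m)))
    (φ : L.Formula (Fin l ⊕ Fin m)) {B : Set (Fin l → M)} (hB : B.Finite) :
    (phiTypes p φ B).Finite :=
  hB.finite_subsets.subset fun _ h => h.1

theorem exists_holds_iff_of_mem_phiTypes {A : Set M} {m l : ℕ} {p : Set (L[[A]].Formula (Fin m))}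
    {φ : L.Formula (Fin l ⊕ Fin m)} {B B₀ : Set (Fin l → M)} (hB : B.Finite)
    (h : B₀ ∈ phiTypes p φ B) {p₀ : Set (L[[A]].Formula (Fin m))} (hp₀ : p₀ ⊆ p)
    (hfin : p₀.Finite) : ∃ c : Fin m → M, Realizes p₀ c ∧ ∀ b ∈ B, (Holds φ b c ↔ b ∈ B₀) := by
  have e1 : {S : Set (Fin m → M) | ∃ b ∈ B₀, S = {c | Holds φ b c}}.Finite := by
    convert! (hB.subset h.1).image (fun b => {c : Fin m → M | Holds φ b c}) using 1
    ext S
    simp [eq_comm]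
  have e2 : {S : Set (Fin m → M) | ∃ b ∈ B \ B₀, S = {c | ¬ Holds φ b c}}.Finite := by
    convert! (hB.subset (Set.sdiff_subset (t := B₀))).image
      (fun b => {c : Fin m → M | ¬ Holds φ b c}) using 1
    ext S
    simp [eq_comm]
  obtain ⟨c, hc, hcS⟩ := h.2 p₀ hp₀ hfin _ subset_rfl (e1.union e2)
  refine ⟨c, hc, fun b hb => ⟨fun hh => ?_, fun hb₀ => hcS _ (Or.inl ⟨b, hb₀, rfl⟩)⟩⟩
  by_contra hb₀
  exact hcS _ (Or.inr ⟨b, ⟨hb, hb₀⟩, rfl⟩) hh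

theorem isBigO_two_mul_pow (k : ℕ) :
    (fun n : ℕ => 2 * (2 * ((n : ℝ) + 1)) ^ k) =O[Filter.atTop]
      (fun n : ℕ => (n : ℝ) ^ (k : ℝ)) := by
  refine Asymptotics.IsBigO.of_bound (2 * 4 ^ k) ?_
  filter_upwards [Filter.eventually_ge_atTop 1] with n hn
  have hn' : (1 : ℝ) ≤ n := by exact_mod_cast hn
  rw [Real.rpow_natCast, Real.norm_of_nonneg (by positivity), Real.norm_of_nonneg (by positivity),
    mul_assoc, ← mul_pow]
  exact mul_le_mul_of_nonneg_left (pow_le_pow_left₀ (by positivity) (by linarith) k) zero_le_two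

/-- If the density of `p` over a sequence is greater than `k`, then `φ` changes its truth value on
`k + 1` disjoint pairs of terms, consistently with `p`. -/
theorem exists_changes_of_lt_vcDensity {A : Set M} {m l : ℕ} {p : Set (L[[A]].Formula (Fin m))}
    {φ : L.Formula (Fin l ⊕ Fin m)} {ι : Type*} [LinearOrder ι] [Infinite ι] {a : ι → Fin l → M}
    {k : ℕ} (h : ((k : ℝ) : EReal) < vcDensity p φ (Set.range a)) :
    ∃ s : Fin ((k + 1) * 2) → ι, StrictMono s ∧
      ∀ p₀ ⊆ p, p₀.Finite → ∃ c : Fin m → M, Realizes p₀ c ∧ ∀ j : Fin (k + 1),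
        ¬ (Holds φ (a (s (finProdFinEquiv (j, 0)))) c ↔
          Holds φ (a (s (finProdFinEquiv (j, 1)))) c) := by
  classical
  -- Without such pairs, every `φ`-type over a finite `B`, read as a word along increasing indices,
  -- has fewer than `k + 1` disjoint changes. The exponent `k` is then admissible and the density is
  -- at most `k`.
  by_contra hno
  refine h.not_ge (sInf_le ⟨k, Nat.cast_nonneg k, rfl, fun n => 2 * (2 * ((n : ℝ) + 1)) ^ k,
    fun n => by positivity, isBigO_two_mul_pow k, fun B hB => ?_⟩)
  -- The sequence `a` may repeat values, so one index is chosen for each element of `B`.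
  choose! idx hidx using fun (b : Fin l → M) (hb : b ∈ B) => hB hb
  have hcard : (B.image idx).card = B.card := Finset.card_image_of_injOn fun b hb b' hb' hbb => by
    rw [← hidx b hb, ← hidx b' hb', hbb]
  let s := (B.image idx).orderEmbOfFin hcard
  have hsB : ∀ x, a (s x) ∈ B := fun x => by
    obtain ⟨b, hb, hbx⟩ := Finset.mem_image.1 ((B.image idx).orderEmbOfFin_mem hcard x)
    change a ((B.image idx).orderEmbOfFin hcard x) ∈ B
    rw [← hbx, hidx b hb]
    exact hb
  have hBs : ∀ b ∈ B, ∃ x, a (s x) = b := fun b hb => by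
    have : idx b ∈ Set.range s := by
      rw [Finset.range_orderEmbOfFin]
      exact Finset.mem_coe.2 (Finset.mem_image_of_mem _ hb)
    obtain ⟨x, hx⟩ := this
    exact ⟨x, by rw [hx, hidx b hb]⟩
  have hle : (phiTypes p φ (B : Set (Fin l → M))).ncard ≤
      {w : List Bool | w.length = B.card ∧ changeCount w < k + 1}.ncard := by
    refine Set.ncard_le_ncard_of_injOn
      (fun B₀ => List.ofFn fun x => decide (a (s x) ∈ B₀)) ?_ ?_ (finite_changeCount_lt _ _)
    · intro B₀ hB₀
      refine ⟨by simp, ?_⟩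
      by_contra! hk
      obtain ⟨f, hf, hfw⟩ := exists_strictMono_of_le_changeCount _ hk
      -- Only the values of `f` up to `2k + 1` are known to be positions of the word; they suffice
      -- for `k + 1` pairs.
      have hlt : ∀ x : Fin ((k + 1) * 2), f x < B.card := fun x =>
        (hf.monotone (by omega : (x : ℕ) ≤ 2 * k + 1)).trans_lt
          (by simpa using (hfw k (Nat.lt_succ_self k)).1)
      refine hno ⟨fun x => s ⟨f x, hlt x⟩, fun x y hxy => s.strictMono (hf hxy),
        fun p₀ hp₀ hfin => ?_⟩
      obtain ⟨c, hc, hcB⟩ := exists_holds_iff_of_mem_phiTypes B.finite_toSet hB₀ hp₀ hfin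
      refine ⟨c, hc, fun j => ?_⟩
      rw [hcB _ (hsB _), hcB _ (hsB _)]
      have h0 : ((finProdFinEquiv (j, (0 : Fin 2)) : Fin ((k + 1) * 2)) : ℕ) = 2 * j := by
        simp [finProdFinEquiv]
      have h1 : ((finProdFinEquiv (j, (1 : Fin 2)) : Fin ((k + 1) * 2)) : ℕ) = 2 * j + 1 := by
        simp [finProdFinEquiv, add_comm]
      have hne := (hfw j j.2).2
      have hg : ∀ (y : ℕ) (hy : y < B.card),
          (List.ofFn fun x => decide (a (s x) ∈ B₀)).getD y false =
            decide (a (s ⟨y, hy⟩) ∈ B₀) := fun y hy => by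
        rw [List.getD_eq_getElem _ _ (by simpa using hy), List.getElem_ofFn]
      have l0 := hlt (finProdFinEquiv (j, 0))
      have l1 := hlt (finProdFinEquiv (j, 1))
      simp only [h0, h1] at l0 l1 ⊢
      rw [hg _ l0, hg _ l1, ne_eq, decide_eq_decide] at hne
      exact hne
    · intro B₀ hB₀ B₁ hB₁ heq
      have heq' := List.ofFn_injective heq
      have key : ∀ b ∈ B, b ∈ B₀ ↔ b ∈ B₁ := fun b hb => by
        obtain ⟨x, rfl⟩ := hBs b hb
        simpa using congrFun heq' x
      ext b
      exact ⟨fun hb => (key b (hB₀.1 hb)).1 hb, fun hb => (key b (hB₁.1 hb)).2 hb⟩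
  have hfinal := hle.trans (ncard_changeCount_lt_le B.card k)
  beta_reduce
  exact_mod_cast hfinal

theorem not_isBigO_choose {k : ℕ} {r : ℝ} (hr : r < k) :
    ¬ (fun n : ℕ => ((n.choose k : ℕ) : ℝ)) =O[Filter.atTop] (fun n : ℕ => (n : ℝ) ^ r) := by
  intro h
  obtain ⟨C, hC⟩ := ((isTheta_choose k).2.trans h).bound
  have ht : Filter.Tendsto (fun n : ℕ => (n : ℝ) ^ ((k : ℝ) - r)) Filter.atTop Filter.atTop :=
    (tendsto_rpow_atTop (sub_pos.2 hr)).comp tendsto_natCast_atTop_atTop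
  obtain ⟨n, hn, hn1, hn2⟩ := (hC.and ((Filter.eventually_ge_atTop 1).and
    (ht.eventually_gt_atTop C))).exists
  have hpos : (0 : ℝ) < n := by exact_mod_cast hn1
  rw [Real.norm_of_nonneg (by positivity), Real.norm_of_nonneg (by positivity)] at hn
  rw [Real.rpow_sub hpos, Real.rpow_natCast, lt_div_iff₀ (by positivity)] at hn2
  exact absurd hn (not_le.2 hn2)

/-- Different `k`-subsets of `n` terms give different types, so there are at least `n choose k` of
them, which is not `O(n^r)` for `r < k`. -/
theorem le_vcDensity_of_cut {A : Set M} {m : ℕ} {p : Set (L[[A]].Formula (Fin m))} {l : ℕ}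
    {φ : L.Formula (Fin l ⊕ Fin m)} {ι : Type*} [Infinite ι] {a : ι → Fin l → M} {k : ℕ}
    (h : ∀ I' : Finset ι, I'.card = k →
      ∃ c : Fin m → M, Realizes p c ∧ ∀ i, Holds φ (a i) c ↔ i ∈ I') :
    ((k : ℝ) : EReal) ≤ vcDensity p φ (Set.range a) := by
  classical
  refine le_sInf ?_
  rintro _ ⟨r, hr, rfl, f, hf0, hfO, hfB⟩
  rw [EReal.coe_le_coe_iff]
  by_contra! hlt
  have hk : 0 < k := by
    have : (0 : ℝ) < k := hr.trans_lt hlt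
    exact_mod_cast this
  -- If `a i = a i'` with `i ≠ i'`, removing `i'` from a set of `k + 1` indices containing both
  -- leaves a `k`-set that cannot be cut out. Positivity of `k` makes room for both indices.
  have hinj : Function.Injective a := by
    intro i i' hii
    by_contra hne
    obtain ⟨t, ht, htc⟩ := Infinite.exists_superset_card_eq {i, i'} (k + 1)
      ((Finset.card_le_two).trans (by omega))
    obtain ⟨c, -, hc⟩ := h (t.erase i') (by
      rw [Finset.card_erase_of_mem (ht (by simp)), htc]; rfl)
    have h1 := (hc i).2 (Finset.mem_erase.2 ⟨hne, ht (by simp)⟩)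
    rw [hii] at h1
    simpa using (hc i').1 h1
  refine not_isBigO_choose hlt (Asymptotics.IsBigO.trans ?_ hfO)
  refine Asymptotics.IsBigO.of_bound 1 (Filter.Eventually.of_forall fun n => ?_)
  rw [Real.norm_of_nonneg (by positivity), Real.norm_of_nonneg (hf0 n), one_mul]
  obtain ⟨t, ht⟩ := Infinite.exists_subset_card_eq ι n
  have hB := hfB (t.image a) (by intro x hx; simp at hx; obtain ⟨i, -, rfl⟩ := hx; exact ⟨i, rfl⟩)
  rw [Finset.card_image_of_injective _ hinj, ht] at hB
  refine le_trans ?_ hB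
  have hle : ((t.powersetCard k : Finset (Finset ι)) : Set (Finset ι)).ncard ≤
      (phiTypes p φ ((t.image a : Finset (Fin l → M)) : Set (Fin l → M))).ncard := by
    refine Set.ncard_le_ncard_of_injOn (fun I' => a '' (I' : Set ι)) ?_ ?_
      (phiTypes_finite p φ (Finset.finite_toSet _))
    · intro I' hI'
      obtain ⟨hsub, hcard⟩ := Finset.mem_powersetCard.1 (Finset.mem_coe.1 hI')
      obtain ⟨c, hc, hcI⟩ := h I' hcard
      refine ⟨?_, fun p₀ hp₀ _ Γ₀ hΓ₀ _ => ⟨c, fun ψ hψ => hc ψ (hp₀ hψ), fun S hS => ?_⟩⟩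
      · rw [Finset.coe_image]
        exact Set.image_mono (Finset.coe_subset.2 hsub)
      · rcases hΓ₀ hS with ⟨_, ⟨i, hi, rfl⟩, rfl⟩ | ⟨b, ⟨hb, hb'⟩, rfl⟩
        · exact (hcI i).2 hi
        · obtain ⟨i, -, rfl⟩ := Finset.mem_image.1 (Finset.mem_coe.1 hb)
          exact fun hh => hb' ⟨i, (hcI i).1 hh, rfl⟩
    · intro I' _ I'' _ heq
      exact Finset.coe_injective (hinj.image_injective heq)
  rw [Set.ncard_coe_finset, Finset.card_powersetCard, ht] at hle
  exact_mod_cast hle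

end Density

/-! ### The equivalences -/

section Main

variable {L : FirstOrder.Language.{u, v}} {M : Type w} [L.Structure M]

theorem hasRandomnessPatternIn_of_lt_vcDensity {κ : Cardinal.{w}} (hκ : ℵ₀ < κ)
    (hM : IsSaturated L M κ) {A : Set M} (hA : #A < κ) [Nonempty M] {m : ℕ}
    {p : Set (L[[A]].Formula (Fin m))} (hp : IsPartialType p)
    {Δ : ∀ l : ℕ, Set (L.Formula (Fin l ⊕ Fin m))} (hΔ : BooleanClosed Δ) {k l : ℕ}
    {φ : L.Formula (Fin l ⊕ Fin m)} (hφ : φ ∈ Δ l) {ι : Type*} [LinearOrder ι] [Infinite ι]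
    {a : ι → Fin l → M} (ha : Indiscernible L A a)
    (h : (((k : ℝ) - 1 : ℝ) : EReal) < vcDensity p φ (Set.range a)) :
    HasRandomnessPatternIn p Δ k := by
  rcases k with _ | k
  -- For `k = 0` the density hypothesis is not needed: consistency of `p` alone gives the empty
  -- pattern.
  · exact hp.hasRandomnessPatternIn_zero Δ
  · rw [Nat.cast_succ, add_sub_cancel_right] at h
    obtain ⟨s, hs, hc⟩ := exists_changes_of_lt_vcDensity h
    exact ha.hasRandomnessPatternIn hκ hM hA hΔ hφ hs hc

theorem vcDensity_tfae {κ : Cardinal.{w}} (hκ : ℵ₀ < κ) (hM : IsSaturated L M κ) {A : Set M}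
    (hA : #A < κ) [Nonempty M] {m : ℕ} {p : Set (L[[A]].Formula (Fin m))} (hp : IsPartialType p)
    (k : ℕ) {Δ : ∀ l : ℕ, Set (L.Formula (Fin l ⊕ Fin m))} (hΔ : BooleanClosed Δ) :
    List.TFAE
      [HasRandomnessPatternIn p Δ k,
        ∃ (l : ℕ) (φ : L.Formula (Fin l ⊕ Fin m)) (ι : Type w) (_ : LinearOrder ι)
          (_ : Infinite ι) (a : ι → Fin l → M), φ ∈ Δ l ∧ Indiscernible L A a ∧
            (((k : ℝ) : EReal)) ≤ vcDensity p φ (Set.range a),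
        ∃ (l : ℕ) (φ : L.Formula (Fin l ⊕ Fin m)) (ι : Type w) (_ : LinearOrder ι)
          (_ : Infinite ι) (a : ι → Fin l → M), φ ∈ Δ l ∧ Indiscernible L A a ∧
            (((k : ℝ) - 1 : ℝ) : EReal) < vcDensity p φ (Set.range a)] := by
  tfae_have 1 → 2 := fun h => by
    obtain ⟨l, φ, a, hφ, ha, hcut⟩ := h.exists_cut hκ hM hA hΔ
    exact ⟨l, φ, ULift.{w} ℕ, inferInstance, inferInstance, a, hφ, ha, le_vcDensity_of_cut hcut⟩
  tfae_have 2 → 3 := fun ⟨l, φ, ι, i₁, i₂, a, hφ, ha, h⟩ =>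
    ⟨l, φ, ι, i₁, i₂, a, hφ, ha, lt_of_lt_of_le (EReal.coe_lt_coe_iff.2 (by linarith)) h⟩
  tfae_have 3 → 1 := fun ⟨_, _, _, _, _, _, hφ, ha, h⟩ =>
    hasRandomnessPatternIn_of_lt_vcDensity hκ hM hA hp hΔ hφ ha h
  tfae_finish

end Main

end DpRank

theorem mainTheorem8 {L : FirstOrder.Language.{u, v}} {M : Type w} [L.Structure M] [Nonempty M]
    (κ : Cardinal.{w}) (hκ : Cardinal.aleph0 < κ) (hM : DpRank.IsSaturated L M κ)
    (A : Set M) (hA : Cardinal.mk A < κ)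
    {m : ℕ} (p : Set (L[[A]].Formula (Fin m))) (hp : DpRank.IsPartialType p) (k : ℕ) :
    List.TFAE
      [ DpRank.DpRankGE p k,
        DpRank.HasRandomnessPattern p k,
        ∃ (l : ℕ) (φ : L.Formula (Fin l ⊕ Fin m)) (ι : Type w) (_ : LinearOrder ι)
          (_ : Infinite ι) (a : ι → Fin l → M),
          DpRank.Indiscernible L A a ∧
            (((k : ℝ) : EReal)) ≤ DpRank.vcDensity p φ (Set.range a),
        ∃ (l : ℕ) (φ : L.Formula (Fin l ⊕ Fin m)) (ι : Type w) (_ : LinearOrder ι)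
          (_ : Infinite ι) (a : ι → Fin l → M),
          DpRank.Indiscernible L A a ∧
            (((k : ℝ) - 1 : ℝ) : EReal) < DpRank.vcDensity p φ (Set.range a),
        ∃ (l : ℕ) (φ : L.Formula (Fin l ⊕ Fin m)) (ι : Type w) (_ : LinearOrder ι)
          (_ : Infinite ι) (a : ι → Fin l → M),
          DpRank.Indiscernible L A a ∧
            ∀ I' : Finset ι, I'.card = k →
              ∃ c : Fin m → M, DpRank.Realizes p c ∧ ∀ i, DpRank.Holds φ (a i) c ↔ i ∈ I',
        ∃ (l : ℕ) (φ : L.Formula (Fin l ⊕ Fin m)), DpRank.AltRankGE p φ (2 * k) ] ∧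
    ∀ Δ : (∀ l : ℕ, Set (L.Formula (Fin l ⊕ Fin m))), DpRank.BooleanClosed Δ →
      List.TFAE
        [ DpRank.HasRandomnessPatternIn p Δ k,
          ∃ (l : ℕ) (φ : L.Formula (Fin l ⊕ Fin m)) (ι : Type w) (_ : LinearOrder ι)
            (_ : Infinite ι) (a : ι → Fin l → M),
            φ ∈ Δ l ∧ DpRank.Indiscernible L A a ∧
              (((k : ℝ) : EReal)) ≤ DpRank.vcDensity p φ (Set.range a),
          ∃ (l : ℕ) (φ : L.Formula (Fin l ⊕ Fin m)) (ι : Type w) (_ : LinearOrder ι)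
            (_ : Infinite ι) (a : ι → Fin l → M),
            φ ∈ Δ l ∧ DpRank.Indiscernible L A a ∧
              (((k : ℝ) - 1 : ℝ) : EReal) < DpRank.vcDensity p φ (Set.range a) ] := by
  refine ⟨?_, fun Δ hΔ => DpRank.vcDensity_tfae hκ hM hA hp k hΔ⟩
  -- Taking `Δ` to be the set of all formulas links the two density conditions to the unrestricted
  -- pattern.
  have hdens := DpRank.vcDensity_tfae hκ hM hA hp k (DpRank.booleanClosed_univ L m)
  tfae_have 1 → 2 := fun h => h.hasRandomnessPattern hκ hM hA hp
  tfae_have 2 → 1 := fun h => h.dpRankGE hκ hM hA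
  tfae_have 2 → 5 := fun h => by
    obtain ⟨l, φ, a, -, ha, hcut⟩ := (DpRank.hasRandomnessPatternIn_univ.2 h).exists_cut hκ hM hA
      (DpRank.booleanClosed_univ L m)
    exact ⟨l, φ, ULift.{w} ℕ, inferInstance, inferInstance, a, ha, hcut⟩
  tfae_have 5 → 6 := fun ⟨l, φ, _, _, _, _, ha, hcut⟩ =>
    ⟨l, φ, DpRank.altRankGE_of_cut ha hcut⟩
  tfae_have 6 → 2 := fun ⟨_, _, h⟩ => h.hasRandomnessPattern hκ hM hA
  tfae_have 2 ↔ 3 := by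
    rw [← DpRank.hasRandomnessPatternIn_univ]
    have h := hdens.out 0 1
    simp only [Set.mem_univ, true_and] at h
    exact h
  tfae_have 2 ↔ 4 := by
    rw [← DpRank.hasRandomnessPatternIn_univ]
    have h := hdens.out 0 2
    simp only [Set.mem_univ, true_and] at h
    exact h
  tfae_finish
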